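/- Let $R$ be a complete noetherian local ring and let $\mathcal{E}$ be an idempotent complete additive $R$-linear category with a (Quillen) exact structure, such that $\mathcal{E}(X,Y)$ is a finitely generated $R$-module for all $X,Y\in\mathcal{E}$ (so $\mathcal{E}$ is Krull–Schmidt). For an object $G$, let $\operatorname{add} G$ denote the full subcategory of all direct summands of finite direct sums of copies of $G$. Assume that $\mathcal{E}$ has a projective generator $P$, i.e. the projective objects of $\mathcal{E}$ are exactly those of $\operatorname{add} P$ and every object $X$ admits a deflation $Q\twoheadrightarrow X$ with $Q\in\operatorname{add}P$. Let $\mathcal{J}$ be the Jacobson radical of $\mathcal{E}$. A conflation $X\xrightarrow{f}Y\xrightarrow{g}Z$ is an AR conflation if $X$ and $Z$ are indecomposable, $f,g\in\mathcal{J}$, every morphism $X\to W$ in $\mathcal{J}$ factors through $f$, and every morphism $W\to Z$ in $\mathcal{J}$ factors through $g$. Assume that $\mathcal{E}$ has AR conflations: every indecomposable non-projective object is the end term, and every indecomposable non-injective object is the first term, of an AR conflation. Let $\operatorname{ind}$ denote the set of isomorphism classes of indecomposable objects of a category, and let $\mathsf{K}_0(\mathcal{E},0)$ be the free abelian group on $\operatorname{ind}\mathcal{E}$;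 an object $X\cong X_1\oplus\dots\oplus X_n$ with all $X_i$ indecomposable has the class $[X]=\sum_i[X_i]$. Let $\operatorname{Ex}(\mathcal{E})$ (resp. $\operatorname{AR}(\mathcal{E})$) be the subgroup of $\mathsf{K}_0(\mathcal{E},0)$ generated by all $[X]-[Y]+[Z]$ where $X\rightarrowtail Y\twoheadrightarrow Z$ is a conflation (resp. an AR conflation). Assume that $\operatorname{AR}(\mathcal{E})\otimes_{\mathbb{Z}}\mathbb{Q}=\operatorname{Ex}(\mathcal{E})\otimes_{\mathbb{Z}}\mathbb{Q}$ inside $\mathsf{K}_0(\mathcal{E},0)\otimes_{\mathbb{Z}}\mathbb{Q}$. Let $\underline{\mathcal{E}}$ be the stable category, the quotient of $\mathcal{E}$ by the ideal of morphisms factoring through a projective object. Let $\Omega\mathcal{E}$ be the full subcategory of those $X\in\mathcal{E}$ that admit an inflation $X\rightarrowtail Q$ with $Q$ projective, and let $\Omega\underline{\mathcal{E}}$ be its essential image in $\underline{\mathcal{E}}$ (equivalently, the essential image of the syzygy functor). Call an additive functor $M:\mathcal{E}^{\mathrm{op}}\to\mathcal{A}b$ effaceable if there are a deflation $f:Y\twoheadrightarrow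 Z$ and an exact sequence $\mathcal{E}(-,Y)\xrightarrow{\mathcal{E}(-,f)}\mathcal{E}(-,Z)\to M\to 0$; such an $M$ vanishes on projectives, hence is a functor on $\underline{\mathcal{E}}$, and its support inside $\operatorname{ind}\underline{\mathcal{E}}$ is $\operatorname{supp}M=\{X\in\operatorname{ind}\underline{\mathcal{E}}\mid M(X)\neq0\}$. Then: 1. For every effaceable $M$, the set $\operatorname{supp}M\cap\operatorname{ind}(\Omega\underline{\mathcal{E}})$ is finite. 2. If in addition $\underline{\mathcal{E}}$ has a weak cogenerator, i.e. an object $A$ such that $\underline{\mathcal{E}}(X,A)=0$ implies $X=0$ in $\underline{\mathcal{E}}$, then $\Omega\mathcal{E}$ is of finite type, i.e. $\Omega\mathcal{E}=\operatorname{add}G$ for some object $G$. -/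

import Mathlib

open CategoryTheory CategoryTheory.Limits Opposite
open scoped TensorProduct ZeroObject

universe w v u

attribute [local instance] hasBinaryBiproducts_of_finite_biproducts

namespace ExactCat

section Additive

variable {D : Type u} [Category.{v} D] [Preadditive D]

/-- The Jacobson radical of a preadditive category: `f : X ⟶ Y` is radical if `1 - g ∘ f` is
invertible for every `g : Y ⟶ X`. -/
def IsRadical {X Y : D} (f : X ⟶ Y) : Prop :=
  ∀ g : Y ⟶ X, IsIso (𝟙 X - f ≫ g)

/-- A weak cogenerator: the only objects without nonzero morphisms to `A` are zero objects. -/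
def IsWeakCogenerator (A : D) : Prop :=
  ∀ X : D, (∀ f : X ⟶ A, f = 0) → IsZero X

section Ind

variable (D) [HasBinaryBiproducts D]

/-- Isomorphism of indecomposable objects. -/
def indSetoid : Setoid {X : D // Indecomposable X} :=
  (isIsomorphicSetoid D).comap Subtype.val

/-- `ind D`: the isomorphism classes of indecomposable objects. -/
def IndClass : Type u := _root_.Quotient (indSetoid D)

variable {D}

/-- The isomorphism class of an indecomposable object. -/
def IndClass.mk (X : D) (hX : Indecomposable X) : IndClass D :=
  _root_.Quotient.mk (indSetoid D) ⟨X, hX⟩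

/-- `ind P` as a subset of `ind D`, for a (full, isomorphism closed, summand closed) subcategory
`P` of `D`. -/
def indOf (P : ObjectProperty D) : Set (IndClass D) :=
  {x | ∃ (X : D) (hX : Indecomposable X), IndClass.mk X hX = x ∧ P X}

/-- The support of a contravariant functor to abelian groups: the isomorphism classes of
indecomposable objects at which it does not vanish. -/
def supp (M : Dᵒᵖ ⥤ AddCommGrpCat.{v}) : Set (IndClass D) :=
  {x | ∃ (X : D) (hX : Indecomposable X), IndClass.mk X hX = x ∧ ¬ IsZero (M.obj (op X))}

/-- A morphism is right almost split if its target is indecomposable, it is radical, and every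
radical morphism to its target factors through it. -/
def IsRightAlmostSplit {Y Z : D} (g : Y ⟶ Z) : Prop :=
  Indecomposable Z ∧ IsRadical g ∧
    ∀ (W : D) (h : W ⟶ Z), IsRadical h → ∃ k : W ⟶ Y, k ≫ g = h

/-- A morphism is left almost split if its source is indecomposable, it is radical, and every
radical morphism from its source factors through it. -/
def IsLeftAlmostSplit {X Y : D} (f : X ⟶ Y) : Prop :=
  Indecomposable X ∧ IsRadical f ∧
    ∀ (W : D) (h : X ⟶ W), IsRadical h → ∃ k : Y ⟶ W, f ≫ k = h

end Ind

section Sums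

variable [HasFiniteBiproducts D]

/-- `add G`: the direct summands of finite direct sums of copies of `G`. -/
def addOf (G : D) : ObjectProperty D :=
  fun X => ∃ (n : ℕ) (Y : D), Nonempty (X ⊞ Y ≅ ⨁ fun _ : Fin n => G)

/-- A full subcategory is of finite type if it equals `add G` for some object `G`. -/
def IsFiniteType (P : ObjectProperty D) : Prop :=
  ∃ G : D, P = addOf G

variable (D) in
/-- The free abelian group `K₀(D, 0)` on the isomorphism classes of indecomposable objects. -/
abbrev FreeK0 : Type u := IndClass D →₀ ℤ

/-- `HasClass X x` says that `x = [X]` in `K₀(D, 0)`, that is, `x` is the sum of the classes of the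
indecomposable summands of `X` in a decomposition of `X` into finitely many indecomposables.
(In a Krull-Schmidt category every `X` has exactly one class.) -/
def HasClass (X : D) (x : FreeK0 D) : Prop :=
  ∃ (n : ℕ) (Y : Fin n → D) (hY : ∀ i, Indecomposable (Y i)),
    Nonempty (X ≅ ⨁ Y) ∧ x = ∑ i, Finsupp.single (IndClass.mk (Y i) (hY i)) 1

/-- The subgroup of `K₀(D, 0)` generated by the elements `[X] - [Y] + [Z]`, where `X ⟶ Y ⟶ Z` runs
over a given class of sequences. -/
noncomputable def relationGroup (P : ObjectProperty (ShortComplex D)) : Submodule ℤ (FreeK0 D) :=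
  Submodule.span ℤ {r | ∃ (S : ShortComplex D) (x y z : FreeK0 D), P S ∧
    HasClass S.X₁ x ∧ HasClass S.X₂ y ∧ HasClass S.X₃ z ∧ r = x - y + z}

end Sums

/-- `A ⊗ ℚ` as a subgroup of `K ⊗ ℚ`, for a subgroup `A` of the abelian group `K`
(recall that `ℚ` is flat). -/
noncomputable def tensorRat {K : Type u} [AddCommGroup K] (A : Submodule ℤ K) : Submodule ℤ (K ⊗[ℤ] ℚ) :=
  LinearMap.range (A.subtype.rTensor ℚ)

/-- `f` is the first map of a sequence from the class `P`. -/
def IsFirstMap (P : ObjectProperty (ShortComplex D)) {X Y : D} (f : X ⟶ Y) : Prop :=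
  ∃ (Z : D) (g : Y ⟶ Z) (h : f ≫ g = 0), P (ShortComplex.mk f g h)

/-- `g` is the second map of a sequence from the class `P`. -/
def IsSecondMap (P : ObjectProperty (ShortComplex D)) {Y Z : D} (g : Y ⟶ Z) : Prop :=
  ∃ (X : D) (f : X ⟶ Y) (h : f ≫ g = 0), P (ShortComplex.mk f g h)

variable (D) in
/-- An exact structure (in the sense of Quillen) on an additive category: an isomorphism closed
class of kernel-cokernel pairs, the conflations, such that the first maps (inflations) and the
second maps (deflations) satisfy the usual axioms. -/
structure ExactStructure where
  /-- The conflations. -/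
  conflation : ObjectProperty (ShortComplex D)
  of_iso : ∀ {S T : ShortComplex D}, (S ≅ T) → conflation S → conflation T
  isKernel : ∀ S : ShortComplex D, conflation S →
    Nonempty (IsLimit (KernelFork.ofι S.f S.zero))
  isCokernel : ∀ S : ShortComplex D, conflation S →
    Nonempty (IsColimit (CokernelCofork.ofπ S.g S.zero))
  inflation_id : ∀ X : D, IsFirstMap conflation (𝟙 X)
  deflation_id : ∀ X : D, IsSecondMap conflation (𝟙 X)
  inflation_comp : ∀ {X Y Z : D} (f : X ⟶ Y) (g : Y ⟶ Z),
    IsFirstMap conflation f → IsFirstMap conflation g → IsFirstMap conflation (f ≫ g)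
  deflation_comp : ∀ {X Y Z : D} (f : X ⟶ Y) (g : Y ⟶ Z),
    IsSecondMap conflation f → IsSecondMap conflation g → IsSecondMap conflation (f ≫ g)
  inflation_pushout : ∀ {X Y A : D} (f : X ⟶ Y) (a : X ⟶ A), IsFirstMap conflation f →
    ∃ (B : D) (b : Y ⟶ B) (f' : A ⟶ B), IsPushout f a b f' ∧ IsFirstMap conflation f'
  deflation_pullback : ∀ {Y Z A : D} (g : Y ⟶ Z) (a : A ⟶ Z), IsSecondMap conflation g →
    ∃ (B : D) (b : B ⟶ Y) (g' : B ⟶ A), IsPullback b g' g a ∧ IsSecondMap conflation g'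

end Additive

namespace ExactStructure

variable {C : Type u} [Category.{v} C] [Preadditive C] (E : ExactStructure C)

/-- Inflations. -/
def IsInflation {X Y : C} (f : X ⟶ Y) : Prop := IsFirstMap E.conflation f

/-- Deflations. -/
def IsDeflation {Y Z : C} (g : Y ⟶ Z) : Prop := IsSecondMap E.conflation g

/-- Projective objects of the exact category. -/
def IsProjective : ObjectProperty C := fun P =>
  ∀ ⦃Y Z : C⦄ (g : Y ⟶ Z), E.IsDeflation g → ∀ h : P ⟶ Z, ∃ k : P ⟶ Y, k ≫ g = h

/-- Injective objects of the exact category. -/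
def IsInjective : ObjectProperty C := fun I =>
  ∀ ⦃X Y : C⦄ (f : X ⟶ Y), E.IsInflation f → ∀ h : X ⟶ I, ∃ k : Y ⟶ I, f ≫ k = h

/-- `ΩE`: the objects that admit an inflation into a projective object. -/
def omega : ObjectProperty C := fun X =>
  ∃ (P : C) (f : X ⟶ P), E.IsProjective P ∧ E.IsInflation f

/-- A functor `M` is effaceable if there are a deflation `f : Y ⟶ Z` and an exact sequence
`C(-, Y) ⟶ C(-, Z) ⟶ M ⟶ 0` whose first map is `C(-, f)`. -/
def IsEffaceable (M : Cᵒᵖ ⥤ AddCommGrpCat.{v}) : Prop :=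
  ∃ (Y Z : C) (f : Y ⟶ Z) (p : preadditiveYoneda.obj Z ⟶ M), E.IsDeflation f ∧
    ∀ W : Cᵒᵖ, Function.Exact ((preadditiveYoneda.map f).app W) (p.app W) ∧
      Function.Surjective (p.app W)

/-- Two parallel morphisms are stably equal if their difference factors through a projective. -/
def stableRel : HomRel C := fun X Y f g =>
  ∃ (P : C) (a : X ⟶ P) (b : P ⟶ Y), E.IsProjective P ∧ f - g = a ≫ b

variable {E} in
theorem IsEffaceable.map_eq {M : Cᵒᵖ ⥤ AddCommGrpCat.{v}} [M.Additive] (hM : E.IsEffaceable M)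
    {X Y : C} (f g : X ⟶ Y) (h : E.stableRel f g) : M.map f.op = M.map g.op := by
  obtain ⟨P, a, b, hP, h⟩ := h
  obtain ⟨A, B, d, p, hd, hex⟩ := hM
  have hz : M.map a.op = 0 := by
    ext x
    obtain ⟨y, rfl⟩ := (hex (op P)).2 x
    obtain ⟨k, hk⟩ := hP d hd y
    have : p.app (op P) y = 0 := ((hex (op P)).1 y).2 ⟨k, hk⟩
    rw [this]
    simp
  have h2 : f.op - g.op = b.op ≫ a.op := by
    rw [← op_comp, ← h]; rfl
  rw [← sub_eq_zero, ← M.map_sub, h2, M.map_comp, hz, comp_zero]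

section

variable [HasFiniteBiproducts C]

/-- `P` is a projective generator: the projective objects are those of `add P`, and there are enough
of them. -/
def IsProjectiveGenerator (P : C) : Prop :=
  E.IsProjective = addOf P ∧
    ∀ X : C, ∃ (Q : C) (g : Q ⟶ X), addOf P Q ∧ E.IsDeflation g

/-- AR conflations. -/
def arConflation : ObjectProperty (ShortComplex C) := fun S =>
  E.conflation S ∧ IsLeftAlmostSplit S.f ∧ IsRightAlmostSplit S.g

/-- Every indecomposable non-projective object is the end of an AR conflation and every
indecomposable non-injective object is the start of one. -/
def HasARConflations : Prop :=
  (∀ Z : C, Indecomposable Z → ¬ E.IsProjective Z →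
    ∃ (X Y : C) (f : X ⟶ Y) (g : Y ⟶ Z) (h : f ≫ g = 0),
      E.arConflation (ShortComplex.mk f g h)) ∧
  (∀ X : C, Indecomposable X → ¬ E.IsInjective X →
    ∃ (Y Z : C) (f : X ⟶ Y) (g : Y ⟶ Z) (h : f ≫ g = 0),
      E.arConflation (ShortComplex.mk f g h))

/-- The subgroup `Ex` of `K₀(C, 0)`. -/
noncomputable def exGroup : Submodule ℤ (FreeK0 C) := relationGroup E.conflation

/-- The subgroup `AR` of `K₀(C, 0)`. -/
noncomputable def arGroup : Submodule ℤ (FreeK0 C) := relationGroup E.arConflation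

variable {E} in
theorem IsProjective.biprod {P Q : C} (hP : E.IsProjective P) (hQ : E.IsProjective Q) :
    E.IsProjective (P ⊞ Q) := by
  intro Y Z g hg h
  obtain ⟨k, hk⟩ := hP g hg (biprod.inl ≫ h)
  obtain ⟨l, hl⟩ := hQ g hg (biprod.inr ≫ h)
  exact ⟨biprod.desc k l, by ext <;> simp [hk, hl]⟩

theorem isProjective_zero : E.IsProjective (0 : C) := fun _ _ _ _ _ =>
  ⟨0, (isZero_zero C).eq_of_src _ _⟩

variable {E} in
theorem stableRel_add {X Y : C} (f₁ f₂ g₁ g₂ : X ⟶ Y) (hf : E.stableRel f₁ f₂)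
    (hg : E.stableRel g₁ g₂) : E.stableRel (f₁ + g₁) (f₂ + g₂) := by
  obtain ⟨P, a, b, hP, h⟩ := hf
  obtain ⟨Q, c, d, hQ, h'⟩ := hg
  refine ⟨P ⊞ Q, biprod.lift a c, biprod.desc b d, hP.biprod hQ, ?_⟩
  rw [biprod.lift_desc, ← h, ← h']
  abel

instance stableRel_congruence : Congruence E.stableRel where
  comp_left := by
    rintro X Y Z f g g' ⟨P, a, b, hP, h⟩
    exact ⟨P, f ≫ a, b, hP, by rw [← Preadditive.comp_sub, h, Category.assoc]⟩
  comp_right := by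
    rintro X Y Z f f' g ⟨P, a, b, hP, h⟩
    exact ⟨P, a, b ≫ g, hP, by rw [← Preadditive.sub_comp, h, Category.assoc]⟩
  equivalence := by
    refine ⟨fun f => ⟨0, 0, 0, E.isProjective_zero, by simp⟩, ?_, ?_⟩
    · rintro f g ⟨P, a, b, hP, h⟩
      exact ⟨P, -a, b, hP, by rw [Preadditive.neg_comp, ← h, neg_sub]⟩
    · rintro f g k ⟨P, a, b, hP, h⟩ ⟨Q, c, d, hQ, h'⟩
      refine ⟨P ⊞ Q, biprod.lift a c, biprod.desc b d, hP.biprod hQ, ?_⟩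
      rw [biprod.lift_desc, ← h, ← h']
      abel

/-- The stable category: the quotient of the exact category by the ideal of the morphisms that
factor through a projective object. -/
abbrev Stable : Type u := CategoryTheory.Quotient E.stableRel

/-- The projection to the stable category. -/
abbrev toStable : C ⥤ E.Stable := CategoryTheory.Quotient.functor E.stableRel

instance stablePreadditive : Preadditive E.Stable :=
  CategoryTheory.Quotient.preadditive E.stableRel fun _ _ => stableRel_add

instance toStable_additive : E.toStable.Additive :=
  CategoryTheory.Quotient.functor_additive E.stableRel fun _ _ => stableRel_add

instance stable_hasBinaryBiproducts : HasBinaryBiproducts E.Stable where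
  has_binary_biproduct X Y :=
    have := preservesBinaryBiproducts_of_preservesBiproducts E.toStable
    inferInstanceAs (HasBinaryBiproduct (E.toStable.obj X.as) (E.toStable.obj Y.as))

/-- The essential image of `ΩE` in the stable category, that is, the essential image of the syzygy
functor. -/
def stableOmega : ObjectProperty E.Stable := E.omega.map E.toStable

variable {E} in
/-- An effaceable functor kills the projective objects, so it is a functor on the stable category. -/
def IsEffaceable.onStable {M : Cᵒᵖ ⥤ AddCommGrpCat.{v}} [M.Additive] (hM : E.IsEffaceable M) :
    E.Stableᵒᵖ ⥤ AddCommGrpCat.{v} :=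
  (CategoryTheory.Quotient.lift E.stableRel M.rightOp fun _ _ f g h =>
    congrArg Quiver.Hom.op (hM.map_eq f g h)).leftOp

end

end ExactStructure

end ExactCat

/-! For an inflation `i : W ⟶ Q` with `Q` projective and cokernel `W'`, the functor `Coext i` is
`Ext¹(W', -)`. It is exact in the middle on conflations (`coext_exact`), and the existence of AR
conflations makes its values on indecomposables of finite length (`length_coext_ne_top`). Its length
therefore extends to a linear form on `K₀(C, 0)`. On the class of a conflation this form is the
length of a kernel plus the length of a cokernel; since both are nonnegative, it vanishes exactly
when `Coext i` turns the conflation into a short exact sequence (`coextChar_conflation`). It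
vanishes on an AR conflation whose end term is a summand of neither `W` nor `W'`
(`coextMap_bijective_of_ar`).

For a deflation `g : Y ⟶ Z`, a nonzero multiple of the class of its conflation is a combination of
AR relations, with end terms in a finite set `s`. If `W` and `W'` avoid `s`, the form kills the
class, so `Coext i` is surjective on `g`, and every `W ⟶ Z` factors through `g` because `Q` is
projective. Avoidance by `W'` is reduced to a condition on `W`: unless `W` is a summand of a chosen
syzygy of a member of `s`, the offending summands of `W'` have projective syzygies and can be split
off (`exists_cosyzygy_avoiding`). So only finitely many indecomposable `W` in `ΩE` are exceptional
(`exists_finite_of_isDeflation`).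

The first claim applies this to a deflation presenting the effaceable functor, the second to a
projective cover-like deflation onto the weak cogenerator. -/

/-! ### Commutative algebra over a complete noetherian local ring. -/

open Polynomial in
theorem Polynomial.monic_X_sq_sub_X {S : Type*} [CommRing S] :
    (X ^ 2 - X : S[X]).Monic := by
  nontriviality S
  apply monic_X_pow_sub
  simp

/-- A finite module over a complete noetherian ring is complete. -/
theorem IsAdicComplete.of_module_finite {R : Type*} [CommRing R] [IsNoetherianRing R]
    (I : Ideal R) [IsAdicComplete I R] (M : Type*) [AddCommGroup M] [Module R M]
    [Module.Finite R M] : IsAdicComplete I M := by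
  have h1 : IsHausdorff I M := IsHausdorff.of_le_jacobson I M (IsAdicComplete.le_jacobson_bot I)
  have h2 : IsPrecomplete I M := by
    rw [← AdicCompletion.of_surjective_iff]
    intro y
    obtain ⟨t, rfl⟩ := AdicCompletion.ofTensorProduct_surjective_of_finite I M y
    induction t with
    | zero => exact ⟨0, by simp⟩
    | add a b ha hb =>
      obtain ⟨x, hx⟩ := ha
      obtain ⟨x', hx'⟩ := hb
      exact ⟨x + x', by rw [map_add, map_add, hx, hx']⟩
    | tmul r m =>
      obtain ⟨s, rfl⟩ := AdicCompletion.of_surjective I R r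
      refine ⟨s • m, ?_⟩
      rw [AdicCompletion.ofTensorProduct_tmul]
      ext n
      simp
      rfl
  exact { h1, h2 with }

theorem IsAdicComplete.map_algebraMap {R : Type*} [CommRing R]
    (I : Ideal R) (S : Type*) [CommRing S] [Algebra R S] [h : IsAdicComplete I S] :
    IsAdicComplete (I.map (algebraMap R S)) S := by
  have h1 : IsHausdorff (I.map (algebraMap R S)) S := IsHausdorff.map_algebraMap_iff.2 h.1
  have h2 : IsPrecomplete (I.map (algebraMap R S)) S := IsPrecomplete.map_algebraMap_iff.2 h.2
  exact { h1, h2 with }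

/-- Idempotents lift along the quotient map of a Henselian pair. -/
theorem HenselianRing.exists_isIdempotentElem {S : Type*} [CommRing S] (I : Ideal S)
    [HenselianRing S I] (e : S ⧸ I) (he : IsIdempotentElem e) :
    ∃ f : S, IsIdempotentElem f ∧ Ideal.Quotient.mk I f = e := by
  obtain ⟨a, rfl⟩ := Ideal.Quotient.mk_surjective e
  obtain ⟨f, hf, hfa⟩ := HenselianRing.is_henselian (I := I)
    (Polynomial.X ^ 2 - Polynomial.X) Polynomial.monic_X_sq_sub_X a
    (by
      rw [← Ideal.Quotient.eq_zero_iff_mem]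
      simp only [Polynomial.eval_sub, Polynomial.eval_pow, Polynomial.eval_X, map_sub, map_pow]
      rw [pow_two, he.eq, sub_self])
    (by
      have h : (Ideal.Quotient.mk I a) * Ideal.Quotient.mk I a = Ideal.Quotient.mk I a := he
      -- The derivative `2a - 1` is its own inverse modulo `I`, since `(2a - 1)² = 1 + 4(a² - a)`.
      refine IsUnit.of_mul_eq_one (2 * Ideal.Quotient.mk I a - 1) ?_
      simp
      linear_combination 4 * h)
  refine ⟨f, ?_, by rwa [Ideal.Quotient.eq]⟩
  have := hf.eq_zero
  simp only [Polynomial.eval_sub, Polynomial.eval_pow, Polynomial.eval_X] at this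
  rw [IsIdempotentElem]
  linear_combination this

/-- In a commutative artinian ring without nontrivial idempotents every element is invertible or
nilpotent. -/
theorem IsArtinianRing.isUnit_or_isNilpotent {A : Type*} [CommRing A] [IsArtinianRing A]
    (h : ∀ e : A, IsIdempotentElem e → e = 0 ∨ e = 1) (a : A) : IsUnit a ∨ IsNilpotent a := by
  obtain ⟨n, y, hy⟩ := IsArtinian.exists_pow_succ_smul_dvd a (1 : A)
  simp only [smul_eq_mul, mul_one] at hy
  have h1 : ∀ k, a ^ (n + k) * y ^ k = a ^ n := by
    intro k
    induction k with
    | zero => simp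
    | succ k ih => 
      calc a ^ (n + (k + 1)) * y ^ (k + 1) = a ^ k * y ^ k * (a ^ (n + 1) * y) := by ring
        _ = a ^ (n + k) * y ^ k := by rw [hy]; ring
        _ = a ^ n := ih
  have h2 := h1 (n + 1)
  -- From `a ^ (n + 1) * y = a ^ n` one gets the idempotent attached to the stable power of `a`: if
  -- it is zero, `a ^ n` vanishes; if it is one, `a` is invertible.
  have he : IsIdempotentElem (a ^ (n + 1) * y ^ (n + 1)) := by
    rw [IsIdempotentElem]
    calc _ = (a ^ (n + (n + 1)) * y ^ (n + 1)) * (a * y ^ (n + 1)) := by ring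
      _ = _ := by rw [h2]; ring
  rcases h _ he with h0 | h0
  · right
    refine ⟨n, ?_⟩
    rw [← h2]
    calc _ = a ^ n * (a ^ (n + 1) * y ^ (n + 1)) := by ring
      _ = 0 := by rw [h0, mul_zero]
  · left
    refine IsUnit.of_mul_eq_one (a ^ n * y ^ (n + 1)) ?_
    rw [← h0]
    ring

/-- Completeness of `S` lets idempotents lift from the artinian ring `S ⧸ mS`, where every element
is then a unit or nilpotent. Units lift back because `mS` lies in the Jacobson radical. -/
theorem IsLocalRing.isUnit_or_isUnit_one_sub_of_finite {R : Type*} [CommRing R] [IsLocalRing R]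
    [IsNoetherianRing R] [IsAdicComplete (IsLocalRing.maximalIdeal R) R]
    {S : Type*} [CommRing S] [Algebra R S] [Module.Finite R S]
    (h : ∀ e : S, IsIdempotentElem e → e = 0 ∨ e = 1) (a : S) : IsUnit a ∨ IsUnit (1 - a) := by
  let m := IsLocalRing.maximalIdeal R
  let I := m.map (algebraMap R S)
  have : IsAdicComplete m S := IsAdicComplete.of_module_finite m S
  have : IsAdicComplete I S := IsAdicComplete.map_algebraMap m S
  have : IsArtinianRing (S ⧸ I) := by
    have : IsArtinianRing (R ⧸ m) :=
      have : m.IsMaximal := inferInstanceAs (IsLocalRing.maximalIdeal R).IsMaximal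
      letI := Ideal.Quotient.field m
      inferInstance
    have : Module.Finite (R ⧸ m) (S ⧸ I) := Module.Finite.of_restrictScalars_finite R _ _
    exact IsArtinianRing.of_finite (R ⧸ m) (S ⧸ I)
  have hloc := isLocalHom_of_le_jacobson_bot I (IsAdicComplete.le_jacobson_bot I)
  have hid : ∀ e : S ⧸ I, IsIdempotentElem e → e = 0 ∨ e = 1 := by
    intro e he
    obtain ⟨f, hf, rfl⟩ := HenselianRing.exists_isIdempotentElem I e he
    rcases h f hf with rfl | rfl <;> simp
  rcases IsArtinianRing.isUnit_or_isNilpotent hid (Ideal.Quotient.mk I a) with h | h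
  · exact Or.inl (IsUnit.of_map _ _ h)
  · right
    have := h.isUnit_one_sub
    rw [← map_one (Ideal.Quotient.mk I), ← map_sub] at this
    exact IsUnit.of_map _ _ this

/-- A finite algebra over a complete noetherian local ring is local as soon as it has only the
trivial idempotents. -/
theorem IsLocalRing.of_forall_isIdempotentElem (R : Type*) [CommRing R] [IsLocalRing R]
    [IsNoetherianRing R] [IsAdicComplete (IsLocalRing.maximalIdeal R) R]
    {A : Type*} [Ring A] [Nontrivial A] [Algebra R A] [Module.Finite R A]
    (h : ∀ e : A, IsIdempotentElem e → e = 0 ∨ e = 1) : IsLocalRing A := by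
  refine IsLocalRing.of_isUnit_or_isUnit_one_sub_self fun a => ?_
  -- The subalgebra generated by `a` is commutative, finite over the noetherian ring `R`, and
  -- inherits the absence of nontrivial idempotents, so the commutative case applies to it.
  let φ : Polynomial R →ₐ[R] A := Polynomial.aeval a
  let ψ := Ideal.kerLiftAlg φ
  have hψ : Function.Injective ψ := Ideal.kerLiftAlg_injective φ
  have : IsNoetherian R A := isNoetherian_of_isNoetherianRing_of_finite R A
  have : Module.Finite R (Polynomial R ⧸ RingHom.ker φ) :=
    Module.Finite.of_injective ψ.toLinearMap hψ
  have key := IsLocalRing.isUnit_or_isUnit_one_sub_of_finite (R := R)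
    (S := Polynomial R ⧸ RingHom.ker φ) (fun e he => by
      rcases h (ψ e) (he.map ψ) with h0 | h0
      · left; exact hψ (by rw [h0, map_zero])
      · right; exact hψ (by rw [h0, map_one]))
    (Ideal.Quotient.mk _ Polynomial.X)
  have ha : ψ (Ideal.Quotient.mk _ Polynomial.X) = a := by
    simp [ψ, φ]
  rcases key with h | h
  · left; rw [← ha]; exact h.map ψ
  · right
    have := h.map ψ
    rwa [map_sub, map_one, ha] at this

/-- A finitely generated module killed by a power of the maximal ideal of a noetherian local ring
has finite length. -/
theorem Module.length_ne_top_of_pow_smul_eq_bot {R : Type*} [CommRing R] [IsLocalRing R]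
    [IsNoetherianRing R] {M : Type*} [AddCommGroup M] [Module R M] [Module.Finite R M] (k : ℕ)
    (h : (IsLocalRing.maximalIdeal R ^ k • ⊤ : Submodule R M) = ⊥) : Module.length R M ≠ ⊤ := by
  set m := IsLocalRing.maximalIdeal R
  have : IsArtinianRing (R ⧸ m ^ k) := by
    -- For exponent zero the quotient is the zero ring, which is not local and has to be treated
    -- apart.
    rcases k with _ | k
    · rw [pow_zero, Ideal.one_eq_top]
      infer_instance
    · have : IsLocalRing (R ⧸ m ^ (k + 1)) :=
        have : Nontrivial (R ⧸ m ^ (k + 1)) := Ideal.Quotient.nontrivial_iff.2 fun h =>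
          (IsLocalRing.maximalIdeal.isMaximal R).ne_top
            (top_le_iff.1 (h ▸ Ideal.pow_le_self (Nat.succ_ne_zero k)))
        IsLocalRing.of_surjective' (Ideal.Quotient.mk _) Ideal.Quotient.mk_surjective
      rw [isArtinianRing_iff_isNilpotent_maximalIdeal]
      refine ⟨k + 1, ?_⟩
      have hmax : m.map (Ideal.Quotient.mk (m ^ (k + 1))) = IsLocalRing.maximalIdeal _ := by
        have := Ideal.comap_isMaximal_of_surjective (Ideal.Quotient.mk (m ^ (k + 1)))
          Ideal.Quotient.mk_surjective (K := IsLocalRing.maximalIdeal _)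
        rw [← Ideal.map_comap_of_surjective (Ideal.Quotient.mk (m ^ (k + 1)))
          Ideal.Quotient.mk_surjective (IsLocalRing.maximalIdeal _),
          IsLocalRing.eq_maximalIdeal this]
      rw [← hmax, ← Ideal.map_pow]
      exact Ideal.map_quotient_self _
  have ht : Module.IsTorsionBySet R M (m ^ k : Ideal R) := by
    intro x r
    have : (r : R) • x ∈ (m ^ k • ⊤ : Submodule R M) := Submodule.smul_mem_smul r.2 trivial
    rwa [h] at this
  let _ := ht.module
  have : Module.Finite (R ⧸ m ^ k) M := Module.Finite.of_restrictScalars_finite R _ _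
  have : IsArtinian (R ⧸ m ^ k) M := inferInstance
  have h2 : IsArtinian R M := 
    isArtinian_of_surjective_algebraMap (S := R) (R := R ⧸ m ^ k) Ideal.Quotient.mk_surjective
  exact Module.length_ne_top

/-! ### Krull–Schmidt decompositions. -/

namespace ExactCat

section KrullSchmidt

variable {C : Type u} [Category.{v} C] [Preadditive C]

/-- If `u` inverts `𝟙 X - f ≫ g`, then `𝟙 Y + g ≫ u ≫ f` is the required inverse. This makes the
definition of the radical left-right symmetric. -/
theorem isIso_one_sub_comp_swap {X Y : C} (f : X ⟶ Y) (g : Y ⟶ X) (h : IsIso (𝟙 X - f ≫ g)) :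
    IsIso (𝟙 Y - g ≫ f) := by
  have h1 : f ≫ g ≫ inv (𝟙 X - f ≫ g) = inv (𝟙 X - f ≫ g) - 𝟙 X := by
    have := IsIso.hom_inv_id (𝟙 X - f ≫ g)
    rw [Preadditive.sub_comp, Category.id_comp, Category.assoc] at this
    rw [eq_sub_iff_add_eq', ← sub_eq_iff_eq_add.1 this]
  have h2 : inv (𝟙 X - f ≫ g) ≫ f ≫ g = inv (𝟙 X - f ≫ g) - 𝟙 X := by
    have := IsIso.inv_hom_id (𝟙 X - f ≫ g)
    rw [Preadditive.comp_sub, Category.comp_id] at this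
    rw [eq_sub_iff_add_eq', ← sub_eq_iff_eq_add.1 this]
  refine ⟨𝟙 Y + g ≫ inv (𝟙 X - f ≫ g) ≫ f, ?_, ?_⟩
  · have h3 : g ≫ f ≫ g ≫ inv (𝟙 X - f ≫ g) ≫ f
        = g ≫ inv (𝟙 X - f ≫ g) ≫ f - g ≫ f := by
      have := congrArg (fun t => g ≫ t ≫ f) h1
      simpa using this
    simp only [Preadditive.sub_comp, Preadditive.comp_add, Category.id_comp, Category.comp_id,
      Category.assoc, h3]
    abel
  · have h3 : g ≫ inv (𝟙 X - f ≫ g) ≫ f ≫ g ≫ f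
        = g ≫ inv (𝟙 X - f ≫ g) ≫ f - g ≫ f := by
      have := congrArg (fun t => g ≫ t ≫ f) h2
      simpa using this
    simp only [Preadditive.comp_sub, Preadditive.add_comp, Category.id_comp, Category.comp_id,
      Category.assoc, h3]
    abel

theorem isIso_or_isIso_one_sub {X : C} (hX : IsLocalRing (End X)) (f : X ⟶ X) :
    IsIso f ∨ IsIso (𝟙 X - f) := by
  let f' : End X := f
  have := IsLocalRing.isUnit_or_isUnit_of_add_one (add_sub_cancel f' 1)
  rwa [isUnit_iff_isIso, isUnit_iff_isIso] at this

/-- A morphism from an object with local endomorphism ring is radical or a split monomorphism. -/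
theorem isRadical_or_splitMono {X Y : C} (hX : IsLocalRing (End X)) (f : X ⟶ Y) :
    IsRadical f ∨ ∃ g : Y ⟶ X, f ≫ g = 𝟙 X := by
  by_contra! h
  obtain ⟨h1, h2⟩ := h
  simp only [IsRadical, not_forall] at h1
  obtain ⟨g, hg⟩ := h1
  have := (isIso_or_isIso_one_sub hX (f ≫ g)).resolve_right hg
  exact h2 (g ≫ inv (f ≫ g)) (by rw [← Category.assoc, IsIso.hom_inv_id])

/-- A morphism to an object with local endomorphism ring is radical or a split epimorphism. -/
theorem isRadical_or_splitEpi {X Y : C} (hY : IsLocalRing (End Y)) (f : X ⟶ Y) :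
    IsRadical f ∨ ∃ g : Y ⟶ X, g ≫ f = 𝟙 Y := by
  by_contra! h
  obtain ⟨h1, h2⟩ := h
  simp only [IsRadical, not_forall] at h1
  obtain ⟨g, hg⟩ := h1
  have := (isIso_or_isIso_one_sub hY (g ≫ f)).resolve_right
    fun h => hg (isIso_one_sub_comp_swap g f h)
  exact h2 (inv (g ≫ f) ≫ g) (by rw [Category.assoc, IsIso.inv_hom_id])

/-- If the identity of `W` is a sum of morphisms that factor through the objects `A i`, and `W` has a
local endomorphism ring, then `W` is a retract of one of the `A i`. -/
theorem exists_retract_of_sum {W : C} (hW : IsLocalRing (End W)) {ι : Type*} (s : Finset ι)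
    (A : ι → C) (a : ∀ i, W ⟶ A i) (b : ∀ i, A i ⟶ W) (h : ∑ i ∈ s, a i ≫ b i = 𝟙 W) :
    ∃ i ∈ s, Nonempty (Retract W (A i)) := by
  let f : ι → End W := fun i => a i ≫ b i
  have h' : IsUnit (∑ i ∈ s, f i) := by
    have h2 : ∑ i ∈ s, f i = 1 := h
    rw [h2]; exact isUnit_one
  obtain ⟨i, hi, hu⟩ := IsLocalRing.exists_of_isUnit_sum h'
  rw [isUnit_iff_isIso] at hu
  have hu' : IsIso (a i ≫ b i) := hu
  exact ⟨i, hi, ⟨⟨a i, b i ≫ inv (a i ≫ b i), by rw [← Category.assoc, IsIso.hom_inv_id]⟩⟩⟩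

section

variable {R : Type w} [CommRing R] [IsLocalRing R] [Linear R C]

variable (R) in
/-- The number of generators of the endomorphism ring of `X` as an `R`-module. -/
noncomputable def endRank (X : C) : ℕ :=
  Module.finrank (IsLocalRing.ResidueField R) (IsLocalRing.ResidueField R ⊗[R] (X ⟶ X))

/-- Nakayama's lemma for the endomorphism ring. -/
theorem endRank_pos (hfin : ∀ X Y : C, Module.Finite R (X ⟶ Y)) {X : C} (hX : ¬ IsZero X) :
    0 < endRank R X := by
  have := hfin X X
  rw [endRank, Module.finrank_pos_iff, ← not_subsingleton_iff_nontrivial,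
    IsLocalRing.subsingleton_tensorProduct]
  intro h
  exact hX ((IsZero.iff_id_eq_zero X).2 (h.elim _ _))

end

variable [HasFiniteBiproducts C]

theorem Retract.exists_iso_biprod [IsIdempotentComplete C] {X Y : C} (h : Retract X Y) :
    ∃ Z : C, Nonempty (Y ≅ X ⊞ Z) := by
  obtain ⟨Z, i, e, hie, hei⟩ := IsIdempotentComplete.idempotents_split Y (𝟙 Y - h.r ≫ h.i)
    (by simp)
  have h1 : h.i ≫ e = 0 := by
    have : h.i ≫ (e ≫ i) ≫ e = 0 := by rw [hei]; simp
    simpa [hie] using this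
  have h2 : i ≫ h.r = 0 := by
    have : i ≫ (e ≫ i) ≫ h.r = 0 := by rw [hei]; simp
    simpa [reassoc_of% hie] using this
  refine ⟨Z, ⟨⟨biprod.lift h.r e, biprod.desc h.i i, ?_, ?_⟩⟩⟩
  · rw [biprod.lift_desc, hei]; abel
  · ext <;> simp [h1, h2, hie]

theorem Retract.nonempty_iso [IsIdempotentComplete C] {X Y : C} (h : Retract X Y)
    (hX : ¬ IsZero X) (hY : Indecomposable Y) : Nonempty (X ≅ Y) := by
  obtain ⟨Z, ⟨e⟩⟩ := Retract.exists_iso_biprod h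
  have hZ := (hY.2 _ _ e).resolve_left hX
  exact ⟨(e ≪≫ ⟨biprod.fst, biprod.inl, by
    ext
    · simp
    · simp
    · simp
    · exact hZ.eq_of_src _ _, by simp⟩).symm⟩

theorem idempotent_eq_zero_or_id [IsIdempotentComplete C] {X : C} (hX : Indecomposable X)
    (e : X ⟶ X) (he : e ≫ e = e) : e = 0 ∨ e = 𝟙 X := by
  obtain ⟨Y, i, p, hip, hpi⟩ := IsIdempotentComplete.idempotents_split X e he
  by_cases hY : IsZero Y
  · left
    rw [← hpi, hY.eq_of_src i 0, comp_zero]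
  · right
    obtain ⟨Z, ⟨φ⟩⟩ := Retract.exists_iso_biprod ⟨i, p, hip⟩
    obtain ⟨ψ⟩ := Retract.nonempty_iso ⟨i, p, hip⟩ hY hX
    obtain ⟨Z, j, q, hjq, hqj⟩ := IsIdempotentComplete.idempotents_split X (𝟙 X - e)
      (by simp [he])
    have hZ : IsZero Z := by
      have h1 : i ≫ q = 0 := by
        have : i ≫ (q ≫ j) ≫ q = 0 := by
          rw [hqj, ← hpi]; simp [reassoc_of% hip]
        simpa [hjq] using this
      have h2 : j ≫ p = 0 := by
        have : j ≫ (q ≫ j) ≫ p = 0 := by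
          rw [hqj, ← hpi]; simp [hip]
        simpa [reassoc_of% hjq] using this
      refine (hX.2 Y Z ⟨biprod.lift p q, biprod.desc i j, ?_, ?_⟩).resolve_left hY
      · rw [biprod.lift_desc, hpi, hqj]; abel
      · ext <;> simp [h1, h2, hip, hjq]
    rw [hZ.eq_of_src j 0, comp_zero] at hqj
    exact (sub_eq_zero.1 hqj.symm).symm

theorem Retract.of_biproduct {W : C} (hW : IsLocalRing (End W)) {n : ℕ} {A : Fin n → C}
    (r : Retract W (⨁ A)) : ∃ i, Nonempty (Retract W (A i)) := by
  obtain ⟨i, -, hi⟩ := exists_retract_of_sum hW Finset.univ A (fun i => r.i ≫ biproduct.π A i)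
    (fun i => biproduct.ι A i ≫ r.r) (by
      have h := congrArg (fun t => r.i ≫ t ≫ r.r) (biproduct.total (f := A))
      simp only [Preadditive.comp_sum, Preadditive.sum_comp, Category.id_comp, r.retract,
        Category.assoc] at h ⊢
      exact h)
  exact ⟨i, hi⟩

section Size

variable {R : Type w} [CommRing R] [IsLocalRing R] [Linear R C]

theorem isLocalRing_end [IsNoetherianRing R] [IsAdicComplete (IsLocalRing.maximalIdeal R) R]
    [IsIdempotentComplete C] (hfin : ∀ X Y : C, Module.Finite R (X ⟶ Y))
    (X : C) (hX : Indecomposable X) : IsLocalRing (End X) := by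
  have : Nontrivial (End X) := ⟨0, 1, fun h => hX.1 ((IsZero.iff_id_eq_zero X).2 h.symm)⟩
  have : Module.Finite R (End X) := hfin X X
  exact IsLocalRing.of_forall_isIdempotentElem R fun e he => idempotent_eq_zero_or_id hX e he

/-- Taking diagonal blocks maps `End X` onto `End A × End B`, and surjectivity survives base change
to the residue field. Hence the rank drops strictly on proper summands and can serve as an induction
measure. -/
theorem endRank_add_le (hfin : ∀ X Y : C, Module.Finite R (X ⟶ Y)) {X A B : C} (e : X ≅ A ⊞ B) :
    endRank R A + endRank R B ≤ endRank R X := by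
  have := hfin X X
  have := hfin A A
  have := hfin B B
  let φ : (X ⟶ X) →ₗ[R] (A ⟶ A) × (B ⟶ B) :=
    (Linear.leftComp R A (biprod.inl ≫ e.inv) ∘ₗ Linear.rightComp R X (e.hom ≫ biprod.fst)).prod
      (Linear.leftComp R B (biprod.inr ≫ e.inv) ∘ₗ Linear.rightComp R X (e.hom ≫ biprod.snd))
  have hφ : Function.Surjective φ := fun ⟨a, b⟩ =>
    ⟨e.hom ≫ biprod.map a b ≫ e.inv, by simp [φ, Linear.leftComp, Linear.rightComp]⟩
  have h := LinearMap.finrank_le_finrank_of_surjective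
    (f := φ.baseChange (IsLocalRing.ResidueField R)) (LinearMap.lTensor_surjective _ hφ)
  rw [(TensorProduct.prodRight R (IsLocalRing.ResidueField R) (IsLocalRing.ResidueField R)
    (A ⟶ A) (B ⟶ B)).finrank_eq, Module.finrank_prod] at h
  exact h

/-- Induction over the decompositions of an object. -/
theorem induction_on_decomposition (hfin : ∀ X Y : C, Module.Finite R (X ⟶ Y)) {p : C → Prop}
    (h : ∀ X, (∀ A B : C, (X ≅ A ⊞ B) → ¬ IsZero A → ¬ IsZero B → p A ∧ p B) → p X) (X : C) :
    p X := by
  induction hn : endRank R X using Nat.strong_induction_on generalizing X with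
  | _ n ih =>
    subst hn
    refine h X fun A B e hA hB => ?_
    have := endRank_add_le hfin e
    have := endRank_pos hfin hA
    have := endRank_pos hfin hB
    exact ⟨ih _ (by omega) A rfl, ih _ (by omega) B rfl⟩

theorem hasClass_zero {X : C} (hX : IsZero X) : HasClass X 0 :=
  ⟨0, Fin.elim0, fun i => i.elim0, ⟨⟨0, 0, hX.eq_of_src _ _, by ext i; exact i.elim0⟩⟩, by simp⟩

theorem hasClass_of_indecomposable {X : C} (hX : Indecomposable X) :
    HasClass X (Finsupp.single (IndClass.mk X hX) 1) :=
  ⟨1, fun _ => X, fun _ => hX, ⟨(biproductUniqueIso fun _ : Fin 1 => X).symm⟩, by simp⟩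

theorem HasClass.biprod {X A B : C} {a b : FreeK0 C} (e : X ≅ A ⊞ B) (hA : HasClass A a)
    (hB : HasClass B b) : HasClass X (a + b) := by
  obtain ⟨n, Y, hY, ⟨φ⟩, rfl⟩ := hA
  obtain ⟨m, Z, hZ, ⟨ψ⟩, rfl⟩ := hB
  have hYZ : ∀ i, Indecomposable (Sum.elim Y Z i) := by
    rintro (i | i)
    exacts [hY i, hZ i]
  let W : Fin n ⊕ Fin m → C := Sum.elim Y Z
  let a (i) : Y i ⟶ ⨁ W := biproduct.ι W (Sum.inl i)
  let b (i) : Z i ⟶ ⨁ W := biproduct.ι W (Sum.inr i)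
  let p (i) : ⨁ W ⟶ Y i := biproduct.π W (Sum.inl i)
  let q (i) : ⨁ W ⟶ Z i := biproduct.π W (Sum.inr i)
  have hap (i j) : a i ≫ p j = biproduct.ι Y i ≫ biproduct.π Y j := by
    by_cases hij : i = j
    · subst hij
      exact (biproduct.ι_π_self W _).trans (biproduct.ι_π_self Y _).symm
    · exact (biproduct.ι_π_ne W fun h => hij (Sum.inl_injective h)).trans
        (biproduct.ι_π_ne Y hij).symm
  have hbq (i j) : b i ≫ q j = biproduct.ι Z i ≫ biproduct.π Z j := by
    by_cases hij : i = j
    · subst hij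
      exact (biproduct.ι_π_self W _).trans (biproduct.ι_π_self Z _).symm
    · exact (biproduct.ι_π_ne W fun h => hij (Sum.inr_injective h)).trans
        (biproduct.ι_π_ne Z hij).symm
  have haq (i j) : a i ≫ q j = 0 := biproduct.ι_π_ne W Sum.inl_ne_inr
  have hbp (i j) : b i ≫ p j = 0 := biproduct.ι_π_ne W Sum.inr_ne_inl
  have htot : ∑ i, p i ≫ a i + ∑ i, q i ≫ b i = 𝟙 (⨁ W) := by
    rw [← biproduct.total, Fintype.sum_sum_type]
    rfl
  let θ : (⨁ Y) ⊞ (⨁ Z) ≅ ⨁ W :=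
    { hom := biprod.desc (biproduct.desc a) (biproduct.desc b)
      inv := biprod.lift (biproduct.lift p) (biproduct.lift q)
      hom_inv_id := by ext <;> simp [hap, hbq, haq, hbp]
      inv_hom_id := by rw [biprod.lift_desc, biproduct.lift_desc, biproduct.lift_desc, htot] }
  refine ⟨n + m, fun i => Sum.elim Y Z (finSumFinEquiv.symm i), fun i => hYZ _,
    ⟨e ≪≫ biprod.mapIso φ ψ ≪≫ θ ≪≫
      (biproduct.reindex finSumFinEquiv.symm W).symm⟩, ?_⟩
  rw [Equiv.sum_comp finSumFinEquiv.symm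
    (fun j => (Finsupp.single (IndClass.mk (Sum.elim Y Z j) (hYZ j)) 1 : FreeK0 C)),
    Fintype.sum_sum_type]
  rfl

theorem exists_hasClass (hfin : ∀ X Y : C, Module.Finite R (X ⟶ Y)) (X : C) :
    ∃ x, HasClass X x := by
  refine induction_on_decomposition hfin (p := fun X => ∃ x, HasClass X x) (fun X h => ?_) X
  by_cases hX : IsZero X
  · exact ⟨0, hasClass_zero hX⟩
  by_cases hX' : Indecomposable X
  · exact ⟨_, hasClass_of_indecomposable hX'⟩
  · simp only [Indecomposable, not_and, not_forall, not_or] at hX'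
    obtain ⟨A, B, e, hA, hB⟩ := hX' hX
    obtain ⟨⟨a, ha⟩, ⟨b, hb⟩⟩ := h A B e hA hB
    exact ⟨a + b, HasClass.biprod e ha hb⟩

end Size

end KrullSchmidt

end ExactCat

/-! ### Rational relations, syzygies and almost split conflations. -/

namespace ExactCat

/-- The image of `r` in `K ⧸ A` dies after tensoring with `ℚ`, a localization of `ℤ`, so it is
torsion. -/
theorem exists_smul_mem_of_tensorRat_eq {K : Type u} [AddCommGroup K] {A B : Submodule ℤ K}
    (h : tensorRat A = tensorRat B) {r : K} (hr : r ∈ B) : ∃ n : ℤ, n ≠ 0 ∧ n • r ∈ A := by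
  have h1 : r ⊗ₜ[ℤ] (1 : ℚ) ∈ tensorRat A := by
    rw [h]
    exact ⟨(⟨r, hr⟩ : B) ⊗ₜ 1, LinearMap.rTensor_tmul _ _ _ _⟩
  obtain ⟨t, ht⟩ := h1
  have h2 : A.mkQ r ⊗ₜ[ℤ] (1 : ℚ) = 0 := by
    have h3 : A.mkQ.rTensor ℚ ∘ₗ A.subtype.rTensor ℚ = 0 := by
      rw [← LinearMap.rTensor_comp]
      have : A.mkQ ∘ₗ A.subtype = 0 := by ext; simp
      rw [this, LinearMap.rTensor_zero]
    exact (congrArg (A.mkQ.rTensor ℚ) ht).symm.trans (LinearMap.congr_fun h3 t)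
  have h3 : TensorProduct.mk ℤ ℚ (K ⧸ A) 1 (A.mkQ r) = 0 := by
    have := congrArg (TensorProduct.comm ℤ (K ⧸ A) ℚ) h2
    simpa using this
  rw [IsLocalizedModule.eq_zero_iff (nonZeroDivisors ℤ)] at h3
  obtain ⟨c, hc⟩ := h3
  refine ⟨c, nonZeroDivisors.ne_zero c.2, ?_⟩
  rw [← Submodule.Quotient.mk_eq_zero]
  exact hc

namespace ExactStructure

section Exact

variable {C : Type u} [Category.{v} C] [Preadditive C] {E : ExactStructure C}

section Conflation

variable {X Y Z : C} {f : X ⟶ Y} {g : Y ⟶ Z} {h : f ≫ g = 0}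

theorem mono_of_conflation (hS : E.conflation (ShortComplex.mk f g h)) : Mono f := by
  obtain ⟨l⟩ := E.isKernel _ hS
  exact Fork.IsLimit.mono l

theorem epi_of_conflation (hS : E.conflation (ShortComplex.mk f g h)) : Epi g := by
  obtain ⟨l⟩ := E.isCokernel _ hS
  exact Cofork.IsColimit.epi l

theorem exists_lift (hS : E.conflation (ShortComplex.mk f g h)) {W : C} (t : W ⟶ Y)
    (ht : t ≫ g = 0) : ∃ s : W ⟶ X, s ≫ f = t := by
  obtain ⟨l⟩ := E.isKernel _ hS
  exact ⟨_, (KernelFork.IsLimit.lift' l t ht).2⟩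

theorem exists_desc (hS : E.conflation (ShortComplex.mk f g h)) {W : C} (t : Y ⟶ W)
    (ht : f ≫ t = 0) : ∃ s : Z ⟶ W, g ≫ s = t := by
  obtain ⟨l⟩ := E.isCokernel _ hS
  exact ⟨_, (CokernelCofork.IsColimit.desc' l t ht).2⟩

theorem isInflation_of_conflation (hS : E.conflation (ShortComplex.mk f g h)) :
    E.IsInflation f := ⟨Z, g, h, hS⟩

theorem isDeflation_of_conflation (hS : E.conflation (ShortComplex.mk f g h)) :
    E.IsDeflation g := ⟨X, f, h, hS⟩

end Conflation

/-- A kernel of a deflation is an inflation with the expected cokernel. -/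
theorem conflation_of_isKernel {X Y Z : C} {f : X ⟶ Y} {g : Y ⟶ Z} (h : f ≫ g = 0)
    (hg : E.IsDeflation g) (hf : Mono f)
    (hl : ∀ {W : C} (t : W ⟶ Y), t ≫ g = 0 → ∃ s : W ⟶ X, s ≫ f = t) :
    E.conflation (ShortComplex.mk f g h) := by
  obtain ⟨X', f', h', hS⟩ := hg
  have := mono_of_conflation hS
  obtain ⟨a, ha⟩ := hl f' h'
  obtain ⟨b, hb⟩ := exists_lift hS f h
  refine E.of_iso (S := ShortComplex.mk f' g h') (T := ShortComplex.mk f g h)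
    (ShortComplex.isoMk ⟨a, b, ?_, ?_⟩ (Iso.refl _) (Iso.refl _) ?_ ?_) hS
  · rw [← cancel_mono f', Category.assoc, hb, ha, Category.id_comp]
  · rw [← cancel_mono f, Category.assoc, ha, hb, Category.id_comp]
  · simp [ha]
  · simp

theorem isProjective_of_factor {P Q B : C} (hP : E.IsProjective P) (hQ : E.IsProjective Q)
    (a : B ⟶ P) (b : P ⟶ B) (c : B ⟶ Q) (d : Q ⟶ B) (h : a ≫ b + c ≫ d = 𝟙 B) :
    E.IsProjective B := by
  intro Y Z g hg t
  obtain ⟨k, hk⟩ := hP g hg (b ≫ t)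
  obtain ⟨l, hl⟩ := hQ g hg (d ≫ t)
  refine ⟨a ≫ k + c ≫ l, ?_⟩
  rw [Preadditive.add_comp, Category.assoc, Category.assoc, hk, hl, ← Category.assoc,
    ← Category.assoc, ← Preadditive.add_comp, h, Category.id_comp]

theorem IsProjective.of_retract {P B : C} (hP : E.IsProjective P) (r : Retract B P) :
    E.IsProjective B :=
  isProjective_of_factor hP hP r.i r.r (0 : B ⟶ P) 0 (by simp)

/-- If `W` is not a retract of the syzygy `K` of `Z`, but `Z` is a retract of a cosyzygy of `W`,
then `K` is projective. -/
theorem isProjective_of_retract_cosyzygy {K P Z W Q W' : C} {k : K ⟶ P} {e : P ⟶ Z}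
    {hke : k ≫ e = 0} (hK : E.conflation (ShortComplex.mk k e hke)) (hP : E.IsProjective P)
    {i : W ⟶ Q} {p : Q ⟶ W'} {hip : i ≫ p = 0} (hW : E.conflation (ShortComplex.mk i p hip))
    (hQ : E.IsProjective Q) (r : Retract Z W') (hloc : IsLocalRing (End W))
    (hWK : IsEmpty (Retract W K)) : E.IsProjective K := by
  have := mono_of_conflation hK
  obtain ⟨u, hu⟩ := hQ e (isDeflation_of_conflation hK) (p ≫ r.r)
  obtain ⟨v, hv⟩ := hP p (isDeflation_of_conflation hW) (e ≫ r.i)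
  obtain ⟨α, hα⟩ := exists_lift hW (k ≫ v) (by rw [Category.assoc, hv, reassoc_of% hke, zero_comp])
  obtain ⟨β, hβ⟩ := exists_lift hK (i ≫ u) (by rw [Category.assoc, hu, reassoc_of% hip, zero_comp])
  obtain ⟨h, hh⟩ := exists_lift hK (𝟙 P - v ≫ u) (by simp [hu, reassoc_of% hv])
  -- The lifts `u`, `v` compare the two conflations. Since `Z ⟶ W' ⟶ Z` is the identity, the induced
  -- `α ≫ β` is the identity up to a map through `P`. As `End W` is local, either `W` is a retract
  -- of `K`, which is excluded, or `k` is a split monomorphism.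
  have hsum : 𝟙 K - α ≫ β = k ≫ h := by
    rw [← cancel_mono k, Preadditive.sub_comp, Category.assoc, Category.assoc, hβ, hh,
      reassoc_of% hα]
    simp
  rcases isIso_or_isIso_one_sub hloc (β ≫ α) with h1 | h1
  · exact (hWK.false ⟨β, α ≫ inv (β ≫ α), by rw [← Category.assoc, IsIso.hom_inv_id]⟩).elim
  · have h2 := isIso_one_sub_comp_swap β α h1
    rw [hsum] at h2
    exact hP.of_retract ⟨k, h ≫ inv (k ≫ h), by rw [← Category.assoc, IsIso.hom_inv_id]⟩

variable [HasFiniteBiproducts C]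

/-- A summand with projective syzygies can be removed from a cosyzygy. -/
theorem exists_conflation_of_cosyzygy_biprod {K P Z W Q W' W'' : C} {k : K ⟶ P} {e : P ⟶ Z}
    {hke : k ≫ e = 0} (hK : E.conflation (ShortComplex.mk k e hke)) (hP : E.IsProjective P)
    (hKp : E.IsProjective K)
    {i : W ⟶ Q} {p : Q ⟶ W'} {hip : i ≫ p = 0} (hW : E.conflation (ShortComplex.mk i p hip))
    (hQ : E.IsProjective Q) (φ : W' ≅ Z ⊞ W'') :
    ∃ (B : C) (j : W ⟶ B) (q : B ⟶ W'') (hjq : j ≫ q = 0),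
      E.IsProjective B ∧ E.conflation (ShortComplex.mk j q hjq) := by
  have := mono_of_conflation hK
  have := mono_of_conflation hW
  obtain ⟨B, b, g, hpb, hg⟩ := E.deflation_pullback p (biprod.inr ≫ φ.inv)
    (isDeflation_of_conflation hW)
  let j : W ⟶ B := hpb.lift i 0 (by rw [hip, zero_comp])
  have hjb : j ≫ b = i := hpb.lift_fst _ _ _
  have hjg : j ≫ g = 0 := hpb.lift_snd _ _ _
  refine ⟨B, j, g, hjg, ?_, conflation_of_isKernel hjg hg ?_ ?_⟩
  -- The pullback `B` is the kernel of `Q ⟶ W' ⟶ Z`. As in Schanuel's lemma, comparing it with the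
  -- syzygy `K` writes the identity of `B` as a sum of maps through the projectives `Q` and `K`.
  · obtain ⟨u, hu⟩ := hQ e (isDeflation_of_conflation hK) (p ≫ φ.hom ≫ biprod.fst)
    obtain ⟨v, hv⟩ := hP p (isDeflation_of_conflation hW) (e ≫ biprod.inl ≫ φ.inv)
    obtain ⟨c, hc⟩ := exists_lift hK (b ≫ u) (by simp [hu, reassoc_of% hpb.w])
    let d : K ⟶ B := hpb.lift (k ≫ v) 0 (by simp [hv, reassoc_of% hke])
    have hdb : d ≫ b = k ≫ v := hpb.lift_fst _ _ _
    have hdg : d ≫ g = 0 := hpb.lift_snd _ _ _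
    have hpw : p = p ≫ φ.hom ≫ biprod.fst ≫ biprod.inl ≫ φ.inv +
        p ≫ φ.hom ≫ biprod.snd ≫ biprod.inr ≫ φ.inv := by
      have := congrArg (fun t => p ≫ φ.hom ≫ t ≫ φ.inv) (biprod.total (X := Z) (Y := W''))
      simp only [Preadditive.comp_add, Preadditive.add_comp, Category.assoc, Category.id_comp,
        Iso.hom_inv_id, Category.comp_id] at this
      exact this.symm
    let h : Q ⟶ B := hpb.lift (𝟙 Q - u ≫ v) (p ≫ φ.hom ≫ biprod.snd) (by
      rw [Preadditive.sub_comp, Category.id_comp, Category.assoc, hv, reassoc_of% hu,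
        sub_eq_iff_eq_add']
      simpa using hpw)
    have hhb : h ≫ b = 𝟙 Q - u ≫ v := hpb.lift_fst _ _ _
    have hhg : h ≫ g = p ≫ φ.hom ≫ biprod.snd := hpb.lift_snd _ _ _
    refine isProjective_of_factor hQ hKp b h c d (hpb.hom_ext ?_ ?_)
    · simp [hhb, hdb, reassoc_of% hc]
    · simp [hhg, hdg, reassoc_of% hpb.w]
  · exact ⟨fun s t hst => by rw [← cancel_mono i, ← hjb, reassoc_of% hst]⟩
  · intro T t ht
    obtain ⟨s, hs⟩ := exists_lift hW (t ≫ b) (by rw [Category.assoc, hpb.w, reassoc_of% ht, zero_comp])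
    refine ⟨s, hpb.hom_ext ?_ ?_⟩
    · rw [Category.assoc, hjb, hs]
    · rw [Category.assoc, hjg, ht, comp_zero]

/-- The key property of an almost split conflation `X ⟶ Y ⟶ Z`: its class is the image of any given
nonzero class `ξ` under the pullback along some morphism to the end of `ξ`. -/
theorem exists_factor_of_almostSplit {X Y Z K P W Q W' : C} {f : X ⟶ Y} {g : Y ⟶ Z}
    {hfg : f ≫ g = 0} (hS : E.conflation (ShortComplex.mk f g hfg)) (hf : IsLeftAlmostSplit f)
    {k : K ⟶ P} {e : P ⟶ Z}
    {hke : k ≫ e = 0} (hP : E.IsProjective P)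
    {i : W ⟶ Q} {p : Q ⟶ W'} {hip : i ≫ p = 0} (hW : E.conflation (ShortComplex.mk i p hip))
    (hloc : IsLocalRing (End X)) (l : P ⟶ Y) (hl : l ≫ g = e) (η : K ⟶ X) (hη : η ≫ f = k ≫ l)
    (ξ : W ⟶ X) (hξ : ∀ b : Q ⟶ X, i ≫ b ≠ ξ) :
    ∃ (κ : K ⟶ W) (w : P ⟶ Q) (s : P ⟶ X), κ ≫ i = k ≫ w ∧ η = κ ≫ ξ + k ≫ s := by
  -- The pushout along `ξ` does not split because `ξ` does not factor through `i`; hence `x` is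
  -- radical and factors through the left almost split map `f`.
  obtain ⟨B, b, x, hpo, W₁, c, hxc, hB⟩ := E.inflation_pushout i ξ (isInflation_of_conflation hW)
  have := mono_of_conflation hB
  obtain ⟨k', hk'⟩ := hf.2.2 B x ((isRadical_or_splitMono hloc x).resolve_right (by
    rintro ⟨t, ht⟩
    exact hξ (b ≫ t) (by rw [← Category.assoc, hpo.w, Category.assoc, ht, Category.comp_id])))
  let q : B ⟶ W' := hpo.desc p 0 (by rw [hip, comp_zero])
  have hbq : b ≫ q = p := hpo.inl_desc _ _ _
  have hxq : x ≫ q = 0 := hpo.inr_desc _ _ _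
  -- The cokernel `c` of `x` factors through `q`, so a map killed by `q` lifts along `x`. That is
  -- all that is needed of `q`.
  obtain ⟨θ', hθ'⟩ := exists_desc hW (b ≫ c) (by rw [← Category.assoc, hpo.w, Category.assoc, hxc,
    comp_zero])
  have hqθ' : q ≫ θ' = c := hpo.hom_ext (by rw [← Category.assoc, hbq, hθ'])
    (by rw [← Category.assoc, hxq, zero_comp, hxc])
  obtain ⟨θ, hθ⟩ := exists_desc hS (k' ≫ q) (by rw [← Category.assoc, hk', hxq])
  obtain ⟨w, hw⟩ := hP p (isDeflation_of_conflation hW) (e ≫ θ)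
  obtain ⟨κ, hκ⟩ := exists_lift hW (k ≫ w) (by rw [Category.assoc, hw, reassoc_of% hke, zero_comp])
  obtain ⟨s, hs⟩ := exists_lift hB (l ≫ k' - w ≫ b) (by
    rw [← hqθ', ← Category.assoc, Preadditive.sub_comp, Category.assoc, Category.assoc, hbq, hw,
      ← hθ, reassoc_of% hl, sub_self, zero_comp])
  refine ⟨κ, w, s, hκ, ?_⟩
  rw [← cancel_mono x, Preadditive.add_comp, Category.assoc, Category.assoc, hs, ← hpo.w,
    reassoc_of% hκ, Preadditive.comp_sub, add_sub_cancel, ← reassoc_of% hη, hk']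

/-- A factorization would produce a section of `g`, making the identity of the nonzero object `Z`
radical. So `η` is a nonzero element of `Coext k X`. -/
theorem not_factor_of_almostSplit {X Y Z K P : C} {f : X ⟶ Y} {g : Y ⟶ Z}
    {hfg : f ≫ g = 0} (hg : IsRightAlmostSplit g)
    {k : K ⟶ P} {e : P ⟶ Z}
    {hke : k ≫ e = 0} (hK : E.conflation (ShortComplex.mk k e hke))
    (l : P ⟶ Y) (hl : l ≫ g = e) (η : K ⟶ X) (hη : η ≫ f = k ≫ l) (t : P ⟶ X) : k ≫ t ≠ η := by
  intro ht
  have := epi_of_conflation hK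
  obtain ⟨σ, hσ⟩ := exists_desc hK (l - t ≫ f) (by
    rw [Preadditive.comp_sub, ← hη, ← Category.assoc, ht, sub_self])
  have h1 : σ ≫ g = 𝟙 Z := by
    rw [← cancel_epi e, reassoc_of% hσ, Preadditive.sub_comp, Category.assoc, hfg, hl]
    simp
  have h2 := isIso_one_sub_comp_swap _ _ (hg.2.1 σ)
  rw [h1, sub_self] at h2
  exact hg.1.1 ((IsZero.iff_id_eq_zero Z).2 (by
    rw [← IsIso.hom_inv_id (0 : Z ⟶ Z), zero_comp]))

end Exact

end ExactStructure

end ExactCat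

/-! ### The functor `Coext`, its length, and exactness on conflations. -/

namespace ExactCat

/-- Additivity of the length along a sequence that is exact in the middle. -/
theorem length_add_length_of_exact {R : Type*} [Ring R] {M N P : Type*} [AddCommGroup M]
    [AddCommGroup N] [AddCommGroup P] [Module R M] [Module R N] [Module R P] (f : M →ₗ[R] N)
    (g : N →ₗ[R] P) (h : Function.Exact f g) :
    Module.length R M + Module.length R P =
      Module.length R N + (Module.length R (LinearMap.ker f) +
        Module.length R (P ⧸ LinearMap.range g)) := by
  have h1 := Module.length_eq_add_of_exact (LinearMap.ker f).subtype f.rangeRestrict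
    (Submodule.subtype_injective _) f.surjective_rangeRestrict
    (by rw [LinearMap.exact_iff]; simp)
  have h2 := Module.length_eq_add_of_exact (LinearMap.range f).subtype g.rangeRestrict
    (Submodule.subtype_injective _) g.surjective_rangeRestrict
    (by rw [LinearMap.exact_iff]; simpa using LinearMap.exact_iff.1 h)
  have h3 := Module.length_eq_add_of_exact (LinearMap.range g).subtype (LinearMap.range g).mkQ
    (Submodule.subtype_injective _) (Submodule.mkQ_surjective _)
    (by rw [LinearMap.exact_iff]; simp)
  rw [h1, h2, h3]
  abel

section Coext

variable (R : Type w) [CommRing R] {C : Type u} [Category.{v} C] [Preadditive C] [Linear R C]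

/-- The morphisms `W ⟶ X` that factor through `i : W ⟶ Q`. -/
def factorSubmodule {W Q : C} (i : W ⟶ Q) (X : C) : Submodule R (W ⟶ X) :=
  LinearMap.range (Linear.leftComp R X i)

/-- The morphisms `W ⟶ X` modulo those that factor through `i : W ⟶ Q`. If `Q` is a projective
object and `i` is an inflation with cokernel `W'`, this is `Ext¹(W', X)`. -/
abbrev Coext {W Q : C} (i : W ⟶ Q) (X : C) : Type v := (W ⟶ X) ⧸ factorSubmodule R i X

/-- The functoriality of `Coext` in the target. -/
def coextMap {W Q : C} (i : W ⟶ Q) {X Y : C} (f : X ⟶ Y) : Coext R i X →ₗ[R] Coext R i Y :=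
  Submodule.mapQ _ _ (Linear.rightComp R W f) (by
    rintro _ ⟨b, rfl⟩
    exact ⟨b ≫ f, by simp [Linear.leftComp, Linear.rightComp]⟩)

@[simp]
theorem coextMap_mk {W Q : C} (i : W ⟶ Q) {X Y : C} (f : X ⟶ Y) (a : W ⟶ X) :
    coextMap R i f (Submodule.Quotient.mk a) = Submodule.Quotient.mk (a ≫ f) := rfl

variable {R} in
theorem coext_mk_eq {W Q : C} (i : W ⟶ Q) {X : C} (a b : W ⟶ X) :
    (Submodule.Quotient.mk a : Coext R i X) = Submodule.Quotient.mk b ↔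
      ∃ c : Q ⟶ X, i ≫ c = a - b := Submodule.Quotient.eq _

namespace ExactStructure

variable {E : ExactStructure C} {R}

/-- A map `Q ⟶ Z` lifts along `g` as `Q` is projective; subtracting this lift turns vanishing modulo
`i` into actual vanishing. -/
theorem coext_exact {X Y Z : C} {f : X ⟶ Y} {g : Y ⟶ Z} {hfg : f ≫ g = 0}
    (hS : E.conflation (ShortComplex.mk f g hfg)) {W Q : C} (i : W ⟶ Q) (hQ : E.IsProjective Q) :
    Function.Exact (coextMap R i f) (coextMap R i g) := by
  intro y
  obtain ⟨a, rfl⟩ := Submodule.mkQ_surjective _ y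
  constructor
  · intro h
    obtain ⟨b, hb⟩ := (coext_mk_eq i (a ≫ g) 0).1 h
    obtain ⟨b', rfl⟩ := hQ g (isDeflation_of_conflation hS) b
    obtain ⟨s, hs⟩ := exists_lift hS (a - i ≫ b') (by
      rw [Preadditive.sub_comp, Category.assoc, hb, sub_zero, sub_self])
    refine ⟨Submodule.Quotient.mk s, ?_⟩
    refine (coext_mk_eq i (s ≫ f) a).2 ⟨-b', ?_⟩
    rw [hs, Preadditive.comp_neg]
    abel
  · rintro ⟨x, hx⟩
    obtain ⟨s, rfl⟩ := Submodule.mkQ_surjective _ x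
    rw [← hx]
    refine (coext_mk_eq i ((s ≫ f) ≫ g) 0).2 ⟨0, ?_⟩
    rw [Category.assoc, hfg]
    simp

/-- The error term of a factorization modulo `i` passes through the projective `Q`, hence itself
lifts along `g`. -/
theorem exists_factor_of_coextMap_surjective {X Y Z : C} {f : X ⟶ Y} {g : Y ⟶ Z} {hfg : f ≫ g = 0}
    (hS : E.conflation (ShortComplex.mk f g hfg)) {W Q : C} {i : W ⟶ Q} (hQ : E.IsProjective Q)
    (h : Function.Surjective (coextMap R i g)) (z : W ⟶ Z) : ∃ y : W ⟶ Y, y ≫ g = z := by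
  obtain ⟨y, hy⟩ := h (Submodule.Quotient.mk z)
  obtain ⟨a, rfl⟩ := Submodule.mkQ_surjective _ y
  obtain ⟨b, hb⟩ := (coext_mk_eq i (a ≫ g) z).1 hy
  obtain ⟨b', rfl⟩ := hQ g (isDeflation_of_conflation hS) b
  refine ⟨a - i ≫ b', ?_⟩
  rw [Preadditive.sub_comp, Category.assoc, hb]
  abel

end ExactStructure

variable [HasFiniteBiproducts C]

/-- `Coext` is compatible with finite biproducts. -/
noncomputable def coextBiproduct {W Q : C} (i : W ⟶ Q) {X : C} {n : ℕ} {Y : Fin n → C}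
    (e : X ≅ ⨁ Y) : Coext R i X ≃ₗ[R] ((j : Fin n) → Coext R i (Y j)) :=
  LinearEquiv.ofLinearMap
    (LinearMap.pi fun j => coextMap R i (e.hom ≫ biproduct.π Y j))
    (∑ j, coextMap R i (biproduct.ι Y j ≫ e.inv) ∘ₗ LinearMap.proj j)
    (by
      apply LinearMap.ext
      intro x
      funext j
      obtain ⟨a, ha⟩ : ∃ a : (j : Fin n) → (W ⟶ Y j), ∀ j, Submodule.Quotient.mk (a j) = x j :=
        ⟨fun j => (Submodule.mkQ_surjective _ (x j)).choose,
          fun j => (Submodule.mkQ_surjective _ (x j)).choose_spec⟩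
      simp only [LinearMap.comp_apply, LinearMap.sum_apply, LinearMap.pi_apply, map_sum,
        LinearMap.proj_apply, ← ha, coextMap_mk, LinearMap.id_apply, Category.assoc,
        Iso.inv_hom_id_assoc]
      rw [Finset.sum_eq_single j]
      · simp
      · intro k _ hk
        rw [biproduct.ι_π_ne Y hk, comp_zero, Submodule.Quotient.mk_zero]
      · simp)
    (by
      apply LinearMap.ext
      intro x
      obtain ⟨a, rfl⟩ := Submodule.mkQ_surjective _ x
      have h := congrArg (fun t => a ≫ e.hom ≫ t ≫ e.inv) (biproduct.total (f := Y))
      simp only [Preadditive.comp_sum, Preadditive.sum_comp, Category.id_comp, Category.assoc,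
        Iso.hom_inv_id, Category.comp_id] at h
      simp only [LinearMap.comp_apply, LinearMap.sum_apply, LinearMap.pi_apply,
        LinearMap.proj_apply, coextMap_mk, LinearMap.id_apply, Category.assoc,
        Submodule.mkQ_apply]
      conv_rhs => rw [← h]
      exact (map_sum (Submodule.mkQ (factorSubmodule R i X)) _ _).symm)

/-- `Coext` is invariant under isomorphisms. -/
noncomputable def coextIso {W Q : C} (i : W ⟶ Q) {X Y : C} (e : X ≅ Y) :
    Coext R i X ≃ₗ[R] Coext R i Y :=
  LinearEquiv.ofLinearMap (coextMap R i e.hom) (coextMap R i e.inv)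
    (by
      apply LinearMap.ext
      intro x
      obtain ⟨a, rfl⟩ := Submodule.mkQ_surjective _ x
      simp)
    (by
      apply LinearMap.ext
      intro x
      obtain ⟨a, rfl⟩ := Submodule.mkQ_surjective _ x
      simp)

/-- The length of `Coext` on isomorphism classes of indecomposable objects. -/
noncomputable def coextLength {W Q : C} (i : W ⟶ Q) : IndClass C → ℤ :=
  _root_.Quotient.lift (fun X => ((Module.length R (Coext R i X.1)).toNat : ℤ)) (by
    rintro X Y ⟨e⟩
    rw [(coextIso R i e).length_eq])

/-- The linear extension of the length of `Coext` to `K₀(C, 0)`. -/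
noncomputable def coextChar {W Q : C} (i : W ⟶ Q) : FreeK0 C →ₗ[ℤ] ℤ :=
  Finsupp.linearCombination ℤ (coextLength R i)

variable {R} in
theorem HasClass.coextLength_eq {W Q : C} {i : W ⟶ Q}
    (hfin : ∀ X : C, Indecomposable X → Module.length R (Coext R i X) ≠ ⊤) {X : C} {x : FreeK0 C}
    (h : HasClass X x) : Module.length R (Coext R i X) ≠ ⊤ ∧
      coextChar R i x = (Module.length R (Coext R i X)).toNat := by
  obtain ⟨n, Y, hY, ⟨e⟩, rfl⟩ := h
  rw [(coextBiproduct R i e).length_eq, Module.length_pi_of_fintype]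
  refine ⟨ENat.sum_ne_top.2 fun j _ => hfin _ (hY j), ?_⟩
  rw [ENat.toNat_sum fun j _ => hfin _ (hY j), map_sum, Nat.cast_sum]
  refine Finset.sum_congr rfl fun j _ => ?_
  rw [coextChar, Finsupp.linearCombination_single, one_smul]
  rfl

namespace ExactStructure

variable {E : ExactStructure C} {R}

/-- If there are AR conflations, then the values of `Coext` on indecomposable objects have finite
length. -/
theorem length_coext_ne_top [IsLocalRing R] [IsNoetherianRing R]
    (hfin : ∀ X Y : C, Module.Finite R (X ⟶ Y))
    (henough : ∀ Z : C, ∃ (P : C) (e : P ⟶ Z), E.IsProjective P ∧ E.IsDeflation e)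
    (hAR : E.HasARConflations) {W Q W' : C} {i : W ⟶ Q} {p : Q ⟶ W'} {hip : i ≫ p = 0}
    (hW : E.conflation (ShortComplex.mk i p hip)) {X : C} (hX : Indecomposable X)
    (hloc : IsLocalRing (End X)) : Module.length R (Coext R i X) ≠ ⊤ := by
  by_cases hinj : E.IsInjective X
  · have : Subsingleton (Coext R i X) := by
      rw [Submodule.Quotient.subsingleton_iff, eq_top_iff]
      intro a _
      exact hinj i (isInflation_of_conflation hW) a
    rw [Module.length_eq_zero]
    simp
  obtain ⟨Y, Z, f, g, hfg, hS, hf, hg⟩ := hAR.2 X hX hinj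
  obtain ⟨P, e, hP, K, k, hke, hK⟩ := henough Z
  obtain ⟨l, hl⟩ := hP g (isDeflation_of_conflation hS) e
  obtain ⟨η, hη⟩ := exists_lift hS (k ≫ l) (by rw [Category.assoc, hl, hke])
  have := hfin K X
  have := hfin W X
  set m := IsLocalRing.maximalIdeal R
  -- By Krull's intersection theorem the nonzero class of `η` lies outside some `m ^ n • Coext R k
  -- X`. Every nonzero `ξ` in `Coext R i X` is sent to `η` by an `R`-linear map, so no such `ξ` lies
  -- in `m ^ n • Coext R i X`.
  obtain ⟨n, hn⟩ : ∃ n : ℕ, (Submodule.Quotient.mk η : Coext R k X) ∉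
      (m ^ n • ⊤ : Submodule R (Coext R k X)) := by
    by_contra! h
    have h0 := IsHausdorff.haus (inferInstance : IsHausdorff m (Coext R k X))
      (Submodule.Quotient.mk η) fun n => SModEq.zero.2 (h n)
    obtain ⟨t, ht⟩ := (coext_mk_eq k η 0).1 h0
    exact not_factor_of_almostSplit (f := f) (hfg := hfg) hg hK l hl η hη t (by rw [ht, sub_zero])
  refine Module.length_ne_top_of_pow_smul_eq_bot n ((Submodule.eq_bot_iff _).2 fun x hx => ?_)
  obtain ⟨ξ, rfl⟩ := Submodule.mkQ_surjective _ x
  by_contra hne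
  obtain ⟨κ, w, s, hκ, hs⟩ := exists_factor_of_almostSplit (hke := hke) hS hf hP hW hloc l hl η hη ξ
    (fun b hb => hne ((coext_mk_eq i ξ 0).2 ⟨b, by rw [hb, sub_zero]⟩))
  let φ : Coext R i X →ₗ[R] Coext R k X := Submodule.mapQ _ _ (Linear.leftComp R X κ) (by
    rintro _ ⟨b, rfl⟩
    exact ⟨w ≫ b, by simp [Linear.leftComp, reassoc_of% hκ]⟩)
  have h1 : φ (Submodule.Quotient.mk ξ) = Submodule.Quotient.mk η :=
    (coext_mk_eq k (κ ≫ ξ) η).2 ⟨-s, by rw [hs, Preadditive.comp_neg]; abel⟩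
  apply hn
  rw [← h1]
  have h2 : φ (Submodule.Quotient.mk ξ) ∈ (m ^ n • ⊤ : Submodule R (Coext R i X)).map φ :=
    Submodule.mem_map_of_mem hx
  rw [Submodule.map_smul''] at h2
  exact Submodule.smul_mono le_rfl le_top h2

/-- By exactness in the middle, the alternating sum of lengths is the length of the kernel on the
left plus that of the cokernel on the right. A sum of natural numbers is zero only if both are. -/
theorem coextChar_conflation {W Q : C} {i : W ⟶ Q} (hQ : E.IsProjective Q)
    (hfin : ∀ X : C, Indecomposable X → Module.length R (Coext R i X) ≠ ⊤)
    {S : ShortComplex C} (hS : E.conflation S) {x y z : FreeK0 C} (hx : HasClass S.X₁ x)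
    (hy : HasClass S.X₂ y) (hz : HasClass S.X₃ z) :
    coextChar R i (x - y + z) = 0 ↔ Function.Injective (coextMap R i S.f) ∧
      Function.Surjective (coextMap R i S.g) := by
  obtain ⟨hx1, hx2⟩ := hx.coextLength_eq hfin
  obtain ⟨hy1, hy2⟩ := hy.coextLength_eq hfin
  obtain ⟨hz1, hz2⟩ := hz.coextLength_eq hfin
  have h := length_add_length_of_exact (R := R) _ _ (coext_exact (R := R) hS i hQ)
  rw [← LinearMap.ker_eq_bot, ← Submodule.subsingleton_iff_eq_bot, ← LinearMap.range_eq_top,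
    ← Submodule.Quotient.subsingleton_iff, ← Module.length_eq_zero_iff (R := R),
    ← Module.length_eq_zero_iff (R := R), map_add, map_sub, hx2, hy2, hz2]
  generalize Module.length R (Coext R i S.X₁) = a at *
  generalize Module.length R (Coext R i S.X₂) = b at *
  generalize Module.length R (Coext R i S.X₃) = c at *
  generalize Module.length R (LinearMap.ker (coextMap R i S.f)) = d at *
  generalize Module.length R (_ ⧸ LinearMap.range (coextMap R i S.g)) = e at *
  lift a to ℕ using hx1
  lift b to ℕ using hy1
  lift c to ℕ using hz1
  have hd : d ≠ ⊤ := by rintro rfl; simp at h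
  have he : e ≠ ⊤ := by rintro rfl; simp at h
  lift d to ℕ using hd
  lift e to ℕ using he
  norm_cast at h
  simp only [ENat.toNat_natCast, Nat.cast_eq_zero]
  omega

/-- `Coext` for a conflation `W ⟶ Q ⟶ W'` is exact on an AR conflation whose end term is a retract
of neither `W` nor `W'`. -/
theorem coextMap_bijective_of_ar {S : ShortComplex C} (hS : E.arConflation S)
    (hloc : IsLocalRing (End S.X₃)) {W Q W' : C} {i : W ⟶ Q} {p : Q ⟶ W'} {hip : i ≫ p = 0}
    (hW : E.conflation (ShortComplex.mk i p hip)) (h1 : IsEmpty (Retract S.X₃ W))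
    (h2 : IsEmpty (Retract S.X₃ W')) : Function.Injective (coextMap R i S.f) ∧
      Function.Surjective (coextMap R i S.g) := by
  obtain ⟨hS, hf, hg⟩ := hS
  have := mono_of_conflation hS
  constructor
  · rw [injective_iff_map_eq_zero]
    intro x hx
    obtain ⟨a, rfl⟩ := Submodule.mkQ_surjective _ x
    obtain ⟨b, hb⟩ := (coext_mk_eq i (a ≫ S.f) 0).1 hx
    rw [sub_zero] at hb
    -- The map `c : W' ⟶ S.X₃` is not a split epimorphism, hence radical, and lifts along `S.g`.
    -- Correcting `b` by this lift makes it factor through `S.f`.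
    obtain ⟨c, hc⟩ := exists_desc hW (b ≫ S.g) (by
      rw [← Category.assoc, hb, Category.assoc, S.zero, comp_zero])
    obtain ⟨d, rfl⟩ := hg.2.2 W' c ((isRadical_or_splitEpi hloc c).resolve_right
      fun ⟨t, ht⟩ => h2.false ⟨t, c, ht⟩)
    obtain ⟨s, hs⟩ := exists_lift hS (b - p ≫ d) (by
      rw [Preadditive.sub_comp, Category.assoc, hc, sub_self])
    refine (coext_mk_eq i a 0).2 ⟨s, ?_⟩
    rw [← cancel_mono S.f, Category.assoc, hs, Preadditive.comp_sub, hb, reassoc_of% hip]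
    simp
  · intro z
    obtain ⟨c, rfl⟩ := Submodule.mkQ_surjective _ z
    obtain ⟨d, rfl⟩ := hg.2.2 W c ((isRadical_or_splitEpi hloc c).resolve_right
      fun ⟨t, ht⟩ => h1.false ⟨t, c, ht⟩)
    exact ⟨Submodule.Quotient.mk d, rfl⟩

end ExactStructure

end Coext

end ExactCat

/-! ### Closure properties of `add G` and of `ΩE`. -/

namespace ExactCat

section Add

variable {C : Type u} [Category.{v} C] [Preadditive C]

/-- The morphisms that factor through a finite direct sum of copies of `G`. -/
def factorThrough (G X Y : C) : AddSubmonoid (X ⟶ Y) :=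
  AddSubmonoid.closure {f | ∃ (a : X ⟶ G) (b : G ⟶ Y), a ≫ b = f}

theorem comp_mem_factorThrough {G X Y X' Y' : C} {f : X ⟶ Y} (hf : f ∈ factorThrough G X Y)
    (a : X' ⟶ X) (b : Y ⟶ Y') : a ≫ f ≫ b ∈ factorThrough G X' Y' := by
  induction hf using AddSubmonoid.closure_induction with
  | mem f hf =>
    obtain ⟨c, d, rfl⟩ := hf
    exact AddSubmonoid.subset_closure ⟨a ≫ c, d ≫ b, by simp⟩
  | zero => simp
  | add f g _ _ hf hg =>
    rw [Preadditive.add_comp, Preadditive.comp_add]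
    exact add_mem hf hg

theorem factorThrough_mono {G G' : C} (h : 𝟙 G ∈ factorThrough G' G G) (X Y : C) :
    factorThrough G X Y ≤ factorThrough G' X Y := by
  refine AddSubmonoid.closure_le.2 ?_
  rintro _ ⟨a, b, rfl⟩
  simpa using comp_mem_factorThrough h a b

theorem id_mem_factorThrough_of_retract {G X : C} (r : Retract X G) :
    𝟙 X ∈ factorThrough G X X :=
  AddSubmonoid.subset_closure ⟨r.i, r.r, r.retract⟩

theorem exists_sum_of_mem_factorThrough {G X Y : C} {f : X ⟶ Y} (hf : f ∈ factorThrough G X Y) :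
    ∃ (n : ℕ) (a : Fin n → (X ⟶ G)) (b : Fin n → (G ⟶ Y)), ∑ i, a i ≫ b i = f := by
  induction hf using AddSubmonoid.closure_induction with
  | mem f hf =>
    obtain ⟨c, d, rfl⟩ := hf
    exact ⟨1, fun _ => c, fun _ => d, by simp⟩
  | zero => exact ⟨0, 0, 0, by simp⟩
  | add f g _ _ hf hg =>
    obtain ⟨n, a, b, rfl⟩ := hf
    obtain ⟨m, c, d, rfl⟩ := hg
    exact ⟨n + m, Fin.append a c, Fin.append b d, by simp [Fin.sum_univ_add]⟩

variable [HasFiniteBiproducts C]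

/-- A factorization of the identity through a power of `G` makes `X` a retract, and idempotent
completeness provides the complement. -/
theorem addOf_iff [IsIdempotentComplete C] {G X : C} :
    addOf G X ↔ 𝟙 X ∈ factorThrough G X X := by
  constructor
  · rintro ⟨n, Y, ⟨e⟩⟩
    have h := congrArg (fun t => biprod.inl ≫ e.hom ≫ t ≫ e.inv ≫ biprod.fst)
      (biproduct.total (f := fun _ : Fin n => G))
    simp only [Preadditive.comp_sum, Preadditive.sum_comp, Category.id_comp, Category.assoc,
      Iso.hom_inv_id_assoc, BinaryBicone.inl_fst] at h
    rw [← h]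
    exact sum_mem fun i _ => AddSubmonoid.subset_closure
      ⟨biprod.inl ≫ e.hom ≫ biproduct.π _ i, biproduct.ι (fun _ : Fin n => G) i ≫ e.inv ≫ biprod.fst,
        by simp⟩
  · intro h
    obtain ⟨n, a, b, hab⟩ := exists_sum_of_mem_factorThrough h
    obtain ⟨Y, ⟨e⟩⟩ := Retract.exists_iso_biprod (X := X) (Y := ⨁ fun _ : Fin n => G)
      ⟨biproduct.lift a, biproduct.desc b, by rw [biproduct.lift_desc, hab]⟩
    exact ⟨n, Y, ⟨e.symm⟩⟩

theorem id_biproduct_mem_factorThrough {G X : C} {n : ℕ} {Y : Fin n → C} (e : X ≅ ⨁ Y)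
    (h : ∀ i, 𝟙 (Y i) ∈ factorThrough G (Y i) (Y i)) : 𝟙 X ∈ factorThrough G X X := by
  have h' := congrArg (fun t => e.hom ≫ t ≫ e.inv) (biproduct.total (f := Y))
  simp only [Preadditive.comp_sum, Preadditive.sum_comp, Category.id_comp, Category.assoc,
    Iso.hom_inv_id] at h'
  rw [← h']
  exact sum_mem fun i _ => by
    simpa using comp_mem_factorThrough (h i) (e.hom ≫ biproduct.π Y i) (biproduct.ι Y i ≫ e.inv)

/-- A property of objects that is closed under binary direct sums and summands is closed under
finite direct sums and summands. -/
theorem of_sum_comp_eq_id {p : ObjectProperty C} (h0 : p 0) (hadd : ∀ {A B}, p A → p B → p (A ⊞ B))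
    (hret : ∀ {A B}, Retract A B → p B → p A) {ι : Type*} [Fintype ι] {X : C} (A : ι → C)
    (hA : ∀ i, p (A i)) (a : ∀ i, X ⟶ A i) (b : ∀ i, A i ⟶ X) (h : ∑ i, a i ≫ b i = 𝟙 X) :
    p X := by
  classical
  have key : ∀ s : Finset ι, ∃ (T : C) (c : X ⟶ T) (d : T ⟶ X), p T ∧
      c ≫ d = ∑ i ∈ s, a i ≫ b i := by
    intro s
    induction s using Finset.induction_on with
    | empty => exact ⟨0, 0, 0, h0, by simp⟩
    | insert i s hi ih =>
      obtain ⟨T, c, d, hT, hcd⟩ := ih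
      exact ⟨A i ⊞ T, biprod.lift (a i) c, biprod.desc (b i) d, hadd (hA i) hT, by
        rw [biprod.lift_desc, hcd, Finset.sum_insert hi]⟩
  obtain ⟨T, c, d, hT, hcd⟩ := key Finset.univ
  exact hret ⟨c, d, hcd.trans h⟩ hT

end Add

namespace ExactStructure

variable {C : Type u} [Category.{v} C] [Preadditive C] {E : ExactStructure C}

theorem IsInflation.comp_iso {X Y Y' : C} {f : X ⟶ Y} (hf : E.IsInflation f) (e : Y ≅ Y') :
    E.IsInflation (f ≫ e.hom) := by
  obtain ⟨Z, g, h, hS⟩ := hf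
  exact ⟨Z, e.inv ≫ g, by simp [h], E.of_iso (S := ShortComplex.mk f g h)
    (T := ShortComplex.mk (f ≫ e.hom) (e.inv ≫ g) (by simp [h]))
    (ShortComplex.isoMk (Iso.refl _) e (Iso.refl _) (by simp) (by simp)) hS⟩

theorem omega_of_isProjective {P : C} (hP : E.IsProjective P) : E.omega P :=
  ⟨P, 𝟙 P, hP, E.inflation_id P⟩

theorem omega_of_isInflation {X Y : C} {f : X ⟶ Y} (hf : E.IsInflation f) (hY : E.omega Y) :
    E.omega X := by
  obtain ⟨P, g, hP, hg⟩ := hY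
  exact ⟨P, f ≫ g, hP, E.inflation_comp f g hf hg⟩

theorem isInflation_hom {X Y : C} (e : X ≅ Y) : E.IsInflation e.hom := by
  simpa using IsInflation.comp_iso (E.inflation_id X : E.IsInflation (𝟙 X)) e

variable [HasFiniteBiproducts C]

/-- The kernel of the deflation `𝟙 B` is an inflation from a zero object, and `biprod.inl` is its
pushout along the zero map to `A`. -/
theorem isInflation_inl (A B : C) : E.IsInflation (biprod.inl : A ⟶ A ⊞ B) := by
  obtain ⟨K, f, h, hS⟩ := E.deflation_id B
  have := mono_of_conflation hS
  have hf : f = 0 := by simpa using h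
  have hK : IsZero K := (IsZero.iff_id_eq_zero K).2 (by rw [← cancel_mono f, hf]; simp)
  obtain ⟨T, b, f', hpo, hf'⟩ := E.inflation_pushout f (0 : K ⟶ A) (isInflation_of_conflation hS)
  have hw : f ≫ (biprod.inr : B ⟶ A ⊞ B) = 0 ≫ biprod.inl := hK.eq_of_src _ _
  let e : T ≅ A ⊞ B :=
    { hom := hpo.desc biprod.inr biprod.inl hw
      inv := biprod.desc f' b
      hom_inv_id := hpo.hom_ext (by simp) (by simp)
      inv_hom_id := by ext <;> simp }
  have h2 := IsInflation.comp_iso hf' e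
  rwa [show f' ≫ e.hom = biprod.inl from hpo.inr_desc _ _ _] at h2

theorem IsInflation.biprod_map_id {X P : C} {f : X ⟶ P} (hf : E.IsInflation f) (Y : C) :
    E.IsInflation (biprod.map f (𝟙 Y)) := by
  obtain ⟨T, b, f', hpo, hf'⟩ := E.inflation_pushout f (biprod.inl : X ⟶ X ⊞ Y) hf
  let e : T ≅ P ⊞ Y :=
    { hom := hpo.desc biprod.inl (biprod.map f (𝟙 Y)) (by simp)
      inv := biprod.desc b (biprod.inr ≫ f')
      hom_inv_id := hpo.hom_ext (by simp) (by ext <;> simp [hpo.w])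
      inv_hom_id := by ext <;> simp }
  have h2 := IsInflation.comp_iso hf' e
  rwa [show f' ≫ e.hom = biprod.map f (𝟙 Y) from hpo.inr_desc _ _ _] at h2

theorem omega_of_retract [IsIdempotentComplete C] {X Y : C} (r : Retract X Y) (hY : E.omega Y) :
    E.omega X := by
  obtain ⟨Z, ⟨e⟩⟩ := Retract.exists_iso_biprod r
  exact omega_of_isInflation (isInflation_inl X Z) (omega_of_isInflation (isInflation_hom e.symm) hY)

theorem omega_biprod {X Y : C} (hX : E.omega X) (hY : E.omega Y) : E.omega (X ⊞ Y) := by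
  obtain ⟨P, f, hP, hf⟩ := hX
  obtain ⟨Q, g, hQ, hg⟩ := hY
  refine omega_of_isInflation (hf.biprod_map_id Y) (omega_of_isInflation
    (isInflation_hom (biprod.braiding P Y)) (omega_of_isInflation (hg.biprod_map_id P)
      (omega_of_isProjective (hQ.biprod hP))))

/-! ### Finiteness of the exceptional objects of a deflation. -/

section Main

variable {R : Type w} [CommRing R] [Linear R C]

/-- The set consists of the end terms of AR conflations whose relations combine to `x`. The point is
that it is chosen before `W` and its cosyzygy. -/
theorem exists_finite_of_mem_arGroup
    (hlen : ∀ {W Q W' : C} {i : W ⟶ Q} {p : Q ⟶ W'} {hip : i ≫ p = 0},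
      E.conflation (ShortComplex.mk i p hip) →
      ∀ X : C, Indecomposable X → Module.length R (Coext R i X) ≠ ⊤)
    (hloc : ∀ X : C, Indecomposable X → IsLocalRing (End X)) {x : FreeK0 C} (hx : x ∈ E.arGroup) :
    ∃ s : Set C, s.Finite ∧ (∀ Z ∈ s, Indecomposable Z) ∧
      ∀ {W Q W' : C} {i : W ⟶ Q} {p : Q ⟶ W'} {hip : i ≫ p = 0},
      E.conflation (ShortComplex.mk i p hip) → E.IsProjective Q →
      (∀ Z ∈ s, IsEmpty (Retract Z W)) → (∀ Z ∈ s, IsEmpty (Retract Z W')) →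
      coextChar R i x = 0 := by
  induction hx using Submodule.span_induction with
  | mem x hx =>
    obtain ⟨S, x, y, z, hS, hx, hy, hz, rfl⟩ := hx
    have hZ : Indecomposable S.X₃ := hS.2.2.1
    refine ⟨{S.X₃}, Set.finite_singleton _, by simpa using hZ, fun hW hQ h1 h2 => ?_⟩
    rw [coextChar_conflation hQ (hlen hW) hS.1 hx hy hz]
    exact coextMap_bijective_of_ar hS (hloc _ hZ) hW (h1 _ rfl) (h2 _ rfl)
  | zero => exact ⟨∅, Set.finite_empty, by simp, fun _ _ _ _ => map_zero _⟩
  | add x y _ _ hx hy =>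
    obtain ⟨s, hs, hs1, hs2⟩ := hx
    obtain ⟨t, ht, ht1, ht2⟩ := hy
    refine ⟨s ∪ t, hs.union ht, fun Z hZ => hZ.elim (hs1 Z) (ht1 Z), fun hW hQ h1 h2 => ?_⟩
    rw [map_add, hs2 hW hQ (fun Z hZ => h1 Z (Or.inl hZ)) (fun Z hZ => h2 Z (Or.inl hZ)),
      ht2 hW hQ (fun Z hZ => h1 Z (Or.inr hZ)) (fun Z hZ => h2 Z (Or.inr hZ)), add_zero]
  | smul n x _ hx =>
    obtain ⟨s, hs, hs1, hs2⟩ := hx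
    exact ⟨s, hs, hs1, fun hW hQ h1 h2 => by rw [map_smul, hs2 hW hQ h1 h2, smul_zero]⟩

/-- A cosyzygy of `W` can be chosen without summands from a set `s` of indecomposable objects, if
`W` is not a summand of the syzygies of the objects in `s`. -/
theorem exists_cosyzygy_avoiding [IsLocalRing R] [IsIdempotentComplete C]
    (hfin : ∀ X Y : C, Module.Finite R (X ⟶ Y)) {W : C} (hloc : IsLocalRing (End W)) (s : Set C)
    (hs : ∀ Z ∈ s, ¬ IsZero Z)
    (hK : ∀ Z ∈ s, ∃ (K P : C) (k : K ⟶ P) (e : P ⟶ Z) (hke : k ≫ e = 0),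
      E.conflation (ShortComplex.mk k e hke) ∧ E.IsProjective P ∧ IsEmpty (Retract W K))
    (W' : C) {Q : C} {i : W ⟶ Q} {p : Q ⟶ W'} {hip : i ≫ p = 0}
    (hW : E.conflation (ShortComplex.mk i p hip)) (hQ : E.IsProjective Q) :
    ∃ (B W'' : C) (j : W ⟶ B) (q : B ⟶ W'') (hjq : j ≫ q = 0), E.IsProjective B ∧
      E.conflation (ShortComplex.mk j q hjq) ∧ ∀ Z ∈ s, IsEmpty (Retract Z W'') := by
  induction hn : endRank R W' using Nat.strong_induction_on generalizing W' Q with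
  | _ n ih =>
    subst hn
    by_cases h : ∀ Z ∈ s, IsEmpty (Retract Z W')
    · exact ⟨Q, W', i, p, hip, hQ, hW, h⟩
    push Not at h
    obtain ⟨Z, hZ, ⟨r⟩⟩ := h
    obtain ⟨W'', ⟨φ⟩⟩ := Retract.exists_iso_biprod r
    obtain ⟨K, P, k, e, hke, hK, hP, hWK⟩ := hK Z hZ
    -- Projectivity of the syzygy allows `Z` to be split off from `W'` with the middle term still
    -- projective, which lowers the rank.
    have hKp := isProjective_of_retract_cosyzygy hK hP hW hQ r hloc hWK
    obtain ⟨B, j, q, hjq, hB, hj⟩ := exists_conflation_of_cosyzygy_biprod hK hP hKp hW hQ φ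
    have h1 := endRank_add_le hfin φ
    have h2 := endRank_pos hfin (hs Z hZ)
    exact ih _ (by omega) W'' hj hB rfl

theorem exists_finite_indecomposable_summands [IsLocalRing R] [IsIdempotentComplete C]
    (hfin : ∀ X Y : C, Module.Finite R (X ⟶ Y))
    (hloc : ∀ X : C, Indecomposable X → IsLocalRing (End X)) (X : C) :
    ∃ s : Set C, s.Finite ∧
      ∀ W : C, Indecomposable W → Nonempty (Retract W X) → ∃ L ∈ s, Nonempty (W ≅ L) := by
  obtain ⟨x, n, Y, hY, ⟨e⟩, -⟩ := exists_hasClass hfin X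
  refine ⟨Set.range Y, Set.finite_range Y, fun W hW ⟨r⟩ => ?_⟩
  obtain ⟨i, ⟨r'⟩⟩ := Retract.of_biproduct (hloc W hW) (A := Y)
    ⟨r.i ≫ e.hom, e.inv ≫ r.r, by simp⟩
  exact ⟨Y i, ⟨i, rfl⟩, Retract.nonempty_iso r' hW.1 (hY i)⟩

/-- For a deflation `g : Y ⟶ Z`, there are only finitely many indecomposable objects `W` in `ΩE`
with a morphism `W ⟶ Z` that does not factor through `g`. -/
theorem exists_finite_of_isDeflation [IsLocalRing R] [IsNoetherianRing R] [IsIdempotentComplete C]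
    (hfin : ∀ X Y : C, Module.Finite R (X ⟶ Y))
    (hloc : ∀ X : C, Indecomposable X → IsLocalRing (End X))
    (henough : ∀ Z : C, ∃ (P : C) (e : P ⟶ Z), E.IsProjective P ∧ E.IsDeflation e)
    (hAR : E.HasARConflations) (hEx : tensorRat E.arGroup = tensorRat E.exGroup)
    {Y Z : C} {g : Y ⟶ Z} (hg : E.IsDeflation g) :
    ∃ s : Set C, s.Finite ∧ ∀ W : C, Indecomposable W → E.omega W →
      ∀ z : W ⟶ Z, (∀ y : W ⟶ Y, y ≫ g ≠ z) → ∃ L ∈ s, Nonempty (W ≅ L) := by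
  have hlen : ∀ {W Q W' : C} {i : W ⟶ Q} {p : Q ⟶ W'} {hip : i ≫ p = 0},
      E.conflation (ShortComplex.mk i p hip) →
      ∀ X : C, Indecomposable X → Module.length R (Coext R i X) ≠ ⊤ :=
    fun hW X hX => length_coext_ne_top hfin henough hAR hW hX (hloc X hX)
  obtain ⟨X, f, hfg, hS⟩ := hg
  obtain ⟨x, hx⟩ := exists_hasClass hfin X
  obtain ⟨y, hy⟩ := exists_hasClass hfin Y
  obtain ⟨z, hz⟩ := exists_hasClass hfin Z
  have hr : x - y + z ∈ E.exGroup :=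
    Submodule.subset_span ⟨ShortComplex.mk f g hfg, x, y, z, hS, hx, hy, hz, rfl⟩
  obtain ⟨n, hn, hnr⟩ := exists_smul_mem_of_tensorRat_eq hEx hr
  obtain ⟨s, hs, hs1, hs2⟩ := exists_finite_of_mem_arGroup hlen hloc hnr
  have hsyz : ∀ Z' : C, ∃ (K P : C) (k : K ⟶ P) (e : P ⟶ Z') (hke : k ≫ e = 0),
      E.conflation (ShortComplex.mk k e hke) ∧ E.IsProjective P := by
    intro Z'
    obtain ⟨P, e, hP, K, k, hke, hK⟩ := henough Z'
    exact ⟨K, P, k, e, hke, hK, hP⟩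
  choose K P k e hke hK hP using hsyz
  choose t ht1 ht2 using fun X : C => exists_finite_indecomposable_summands hfin hloc X
  -- The exceptional objects are the AR end terms together with the indecomposable summands of their
  -- chosen syzygies.
  refine ⟨s ∪ ⋃ Z' ∈ s, t (K Z'), hs.union (hs.biUnion fun Z' _ => ht1 _), ?_⟩
  rintro W hW ⟨Q, i, hQ, W', p, hip, hi⟩ c hc
  by_contra! hcon
  have h1 : ∀ Z' ∈ s, IsEmpty (Retract Z' W) := fun Z' hZ' => ⟨fun r =>
    (hcon Z' (Or.inl hZ')).false (Retract.nonempty_iso r (hs1 _ hZ').1 hW).some.symm⟩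
  have h2 : ∀ Z' ∈ s, IsEmpty (Retract W (K Z')) := fun Z' hZ' => ⟨fun r => by
    obtain ⟨L, hL, ⟨e⟩⟩ := ht2 (K Z') W hW ⟨r⟩
    exact (hcon L (Or.inr (Set.mem_biUnion hZ' hL))).false e⟩
  obtain ⟨B, W'', j, q, hjq, hB, hj, h3⟩ := exists_cosyzygy_avoiding hfin (hloc W hW) s
    (fun Z' hZ' => (hs1 Z' hZ').1)
    (fun Z' hZ' => ⟨K Z', P Z', k Z', e Z', hke Z', hK Z', hP Z', h2 Z' hZ'⟩) W' hi hQ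
  have h4 := hs2 hj hB h1 h3
  -- The form takes values in `ℤ`, so the factor `n` can be cancelled.
  rw [map_smul, smul_eq_zero_iff_right hn, coextChar_conflation hB (hlen hj) hS hx hy hz] at h4
  obtain ⟨y, hy⟩ := exists_factor_of_coextMap_surjective hS hB h4.2 c
  exact hc y hy

end Main

/-! ### Passage to the stable category and the two conclusions. -/

section Stable

theorem toStable_map_eq_zero {X Y : C} {f : X ⟶ Y} :
    E.toStable.map f = 0 ↔ ∃ (P : C) (a : X ⟶ P) (b : P ⟶ Y), E.IsProjective P ∧ f = a ≫ b := by
  rw [← E.toStable.map_zero X Y, CategoryTheory.Quotient.functor_map_eq_iff]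
  simp [stableRel]

theorem isProjective_of_isZero_toStable {X : C} (h : IsZero (E.toStable.obj X)) :
    E.IsProjective X := by
  have h1 : E.toStable.map (𝟙 X) = 0 := h.eq_of_src _ _
  obtain ⟨P, a, b, hP, hab⟩ := toStable_map_eq_zero.1 h1
  exact hP.of_retract ⟨a, b, hab.symm⟩

/-- An indecomposable object of the stable category in the image of `ΩE` is the image of an
indecomposable object in `ΩE`. -/
theorem exists_indecomposable_of_stableOmega {R : Type w} [CommRing R] [IsLocalRing R] [Linear R C]
    [IsIdempotentComplete C] (hfin : ∀ X Y : C, Module.Finite R (X ⟶ Y)) {X : E.Stable}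
    (hX : Indecomposable X) (h : E.stableOmega X) :
    ∃ W : C, Indecomposable W ∧ E.omega W ∧ Nonempty (E.toStable.obj W ≅ X) := by
  obtain ⟨W, hW, ⟨e⟩⟩ := h
  revert hW e
  refine induction_on_decomposition hfin (p := fun W => E.omega W → (E.toStable.obj W ≅ X) →
    ∃ W : C, Indecomposable W ∧ E.omega W ∧ Nonempty (E.toStable.obj W ≅ X)) (fun W ih hW e => ?_) W
  by_cases hind : Indecomposable W
  · exact ⟨W, hind, hW, ⟨e⟩⟩
  have hW0 : ¬ IsZero W := fun h => hX.1 ((E.toStable.map_isZero h).of_iso e.symm)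
  simp only [Indecomposable, not_and, not_forall, not_or] at hind
  obtain ⟨A, B, φ, hA, hB⟩ := hind hW0
  obtain ⟨ihA, ihB⟩ := ih A B φ hA hB
  have := preservesBinaryBiproducts_of_preservesBiproducts E.toStable
  let ψ : X ≅ E.toStable.obj A ⊞ E.toStable.obj B :=
    e.symm ≪≫ E.toStable.mapIso φ ≪≫ E.toStable.mapBiprod A B
  have hA' : E.omega A := omega_of_retract ⟨biprod.inl ≫ φ.inv, φ.hom ≫ biprod.fst, by simp⟩ hW
  have hB' : E.omega B := omega_of_retract ⟨biprod.inr ≫ φ.inv, φ.hom ≫ biprod.snd, by simp⟩ hW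
  rcases hX.2 _ _ ψ with h0 | h0
  · exact ihB hB' (ψ ≪≫ ⟨biprod.snd, biprod.inr, by
      ext
      · exact h0.eq_of_src _ _
      · exact h0.eq_of_src _ _
      · simp
      · simp, by simp⟩).symm
  · exact ihA hA' (ψ ≪≫ ⟨biprod.fst, biprod.inl, by
      ext
      · simp
      · simp
      · exact h0.eq_of_src _ _
      · exact h0.eq_of_src _ _, by simp⟩).symm

end Stable

end ExactStructure

end ExactCat

theorem theorem5p2
    {R : Type w} [CommRing R] [IsLocalRing R] [IsNoetherianRing R]
    [IsAdicComplete (IsLocalRing.maximalIdeal R) R]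
    {C : Type u} [Category.{v} C] [Preadditive C] [HasFiniteBiproducts C] [Linear R C]
    [IsIdempotentComplete C]
    (hom_noetherian : ∀ X Y : C, Module.Finite R (X ⟶ Y))
    (E : ExactCat.ExactStructure C)
    (P : C) (hP : E.IsProjectiveGenerator P)
    (hAR : E.HasARConflations)
    (hEx : ExactCat.tensorRat E.arGroup = ExactCat.tensorRat E.exGroup) :
    (∀ (M : Cᵒᵖ ⥤ AddCommGrpCat.{v}) [M.Additive] (hM : E.IsEffaceable M),
      (ExactCat.supp hM.onStable ∩ ExactCat.indOf E.stableOmega).Finite) ∧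
    ((∃ A : E.Stable, ExactCat.IsWeakCogenerator A) → ExactCat.IsFiniteType E.omega) := by
  have hloc : ∀ X : C, Indecomposable X → IsLocalRing (End X) :=
    ExactCat.isLocalRing_end hom_noetherian
  have henough : ∀ Z : C, ∃ (P : C) (e : P ⟶ Z), E.IsProjective P ∧ E.IsDeflation e := by
    intro Z
    obtain ⟨Q, e, hQ, he⟩ := hP.2 Z
    exact ⟨Q, e, hP.1 ▸ hQ, he⟩
  constructor
  · intro M _ hM
    obtain ⟨Y, Z, g, p, hg, hex⟩ := id hM
    obtain ⟨s, hs, hs'⟩ := ExactCat.ExactStructure.exists_finite_of_isDeflation hom_noetherian hloc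
      henough hAR hEx hg
    refine Set.Finite.subset (s := ⋃ L ∈ s, {x | ∃ h : Indecomposable (E.toStable.obj L),
      ExactCat.IndClass.mk _ h = x}) (hs.biUnion fun L _ => Set.Subsingleton.finite ?_) ?_
    · rintro x ⟨h, rfl⟩ y ⟨h', rfl⟩
      rfl
    · rintro _ ⟨⟨X, hX, rfl, hMX⟩, ⟨X', hX', hXX', hO⟩⟩
      obtain ⟨W, hW, hWO, ⟨e⟩⟩ := ExactCat.ExactStructure.exists_indecomposable_of_stableOmega
        hom_noetherian hX' hO
      obtain ⟨e'⟩ : Nonempty (X' ≅ X) := _root_.Quotient.exact hXX'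
      have hMW : ¬ IsZero (M.obj (op W)) := fun h => hMX
        (h.of_iso (hM.onStable.mapIso (e ≪≫ e').op))
      have hMW' : ∃ x : M.obj (op W), x ≠ 0 := by
        by_contra! h
        have : Subsingleton (M.obj (op W)) := ⟨fun a b => by rw [h a, h b]⟩
        exact hMW (AddCommGrpCat.isZero_of_subsingleton _)
      obtain ⟨x, hx⟩ := hMW'
      -- A nonzero element of `M(W)` is represented by a map to `Z` that does not factor through
      -- `g`, so `W` is exceptional for `g`.
      obtain ⟨z, rfl⟩ := (hex (op W)).2 x
      obtain ⟨L, hL, ⟨φ⟩⟩ := hs' W hW hWO z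
        (fun y hy => hx (((hex (op W)).1 z).2 ⟨y, hy⟩))
      have ψ : E.toStable.obj L ≅ X := E.toStable.mapIso φ.symm ≪≫ e ≪≫ e'
      have hind : Indecomposable (E.toStable.obj L) :=
        ⟨fun h => hX.1 (h.of_iso ψ.symm), fun A B θ => hX.2 A B (ψ.symm ≪≫ θ)⟩
      exact Set.mem_biUnion hL ⟨hind, _root_.Quotient.sound ⟨ψ⟩⟩
  · rintro ⟨A, hA⟩
    -- Maps to `A.as` that factor through this deflation are stably zero. A non-projective `W` has a
    -- stably nonzero map to `A`, so if it is indecomposable and in `ΩE` it is exceptional for `e`.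
    obtain ⟨Q, e, hQ, he⟩ := henough A.as
    obtain ⟨s, hs, hs'⟩ := ExactCat.ExactStructure.exists_finite_of_isDeflation hom_noetherian hloc
      henough hAR hEx he
    -- Only the members lying in `ΩE` are kept, so that the generator `P ⊞ T` itself lies in `ΩE`.
    let t : Set C := {L ∈ s | E.omega L}
    have : Finite t := hs.subset (Set.sep_subset _ _)
    obtain ⟨n, ⟨ε⟩⟩ := Finite.exists_equiv_fin t
    let F : Fin n → C := fun i => (ε.symm i).1
    let T : C := ⨁ F
    have h0 : E.omega 0 := ExactCat.ExactStructure.omega_of_isProjective E.isProjective_zero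
    have hT : E.omega T := ExactCat.of_sum_comp_eq_id h0 ExactCat.ExactStructure.omega_biprod
      ExactCat.ExactStructure.omega_of_retract F (fun i => (ε.symm i).2.2) _ _
      biproduct.total
    have hPp : E.IsProjective P := by
      rw [hP.1, ExactCat.addOf_iff]
      exact ExactCat.id_mem_factorThrough_of_retract (Retract.refl P)
    have hG : E.omega (P ⊞ T) :=
      ExactCat.ExactStructure.omega_biprod (ExactCat.ExactStructure.omega_of_isProjective hPp) hT
    refine ⟨P ⊞ T, funext fun X => propext ⟨fun hX => ?_, fun hX => ?_⟩⟩
    · obtain ⟨x, n, Y, hY, ⟨φ⟩, -⟩ := ExactCat.exists_hasClass hom_noetherian X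
      rw [ExactCat.addOf_iff]
      refine ExactCat.id_biproduct_mem_factorThrough φ fun j => ?_
      have hYO : E.omega (Y j) := ExactCat.ExactStructure.omega_of_retract
        ⟨biproduct.ι Y j ≫ φ.inv, φ.hom ≫ biproduct.π Y j, by simp⟩ hX
      by_cases hYp : E.IsProjective (Y j)
      · rw [hP.1, ExactCat.addOf_iff] at hYp
        exact ExactCat.factorThrough_mono (ExactCat.id_mem_factorThrough_of_retract
          ⟨biprod.inl, biprod.fst, by simp⟩) _ _ hYp
      · have hne : ¬ ∀ f : E.toStable.obj (Y j) ⟶ A, f = 0 := fun h => hYp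
          (ExactCat.ExactStructure.isProjective_of_isZero_toStable (hA _ h))
        push Not at hne
        obtain ⟨f, hf⟩ := hne
        obtain ⟨z, rfl⟩ := E.toStable.map_surjective (Y := A.as) f
        obtain ⟨L, hL, ⟨ψ⟩⟩ := hs' (Y j) (hY j) hYO z (fun y hy => hf
          (ExactCat.ExactStructure.toStable_map_eq_zero.2 ⟨Q, y, e, hQ, hy.symm⟩))
        obtain ⟨i, rfl⟩ : ∃ i, F i = L := ⟨ε ⟨L, hL,
          ExactCat.ExactStructure.omega_of_retract ⟨ψ.inv, ψ.hom, by simp⟩ hYO⟩, by simp [F]⟩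
        exact ExactCat.id_mem_factorThrough_of_retract
          ((⟨ψ.hom ≫ biproduct.ι F i, biproduct.π F i ≫ ψ.inv, by simp⟩ : Retract (Y j) T).trans
            ⟨biprod.inr, biprod.snd, by simp⟩)
    · rw [ExactCat.addOf_iff] at hX
      obtain ⟨n, a, b, hab⟩ := ExactCat.exists_sum_of_mem_factorThrough hX
      exact ExactCat.of_sum_comp_eq_id h0 ExactCat.ExactStructure.omega_biprod
        ExactCat.ExactStructure.omega_of_retract (fun _ => P ⊞ T) (fun _ => hG) a b hab
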